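/- **Theorem 3.5.** All ideals in C*-algebras are two-sided and closed, and $K$ denotes the C*-algebra of compact operators on a separable infinite dimensional Hilbert space. Let $(P)$ be a property of C*-algebras which * is *stable*: whenever $A$ and $B$ are C*-algebras, $A$ has $(P)$, and $K \otimes B \cong K \otimes A$, then $B$ has $(P)$; and * *admits largest ideals*: every C*-algebra $A$ contains an ideal $I_P(A)$ which has $(P)$ and which contains every ideal of $A$ that has $(P)$. Let $G$ be a finite abelian group. For an action $\alpha \colon G \to \mathrm{Aut}(A)$ on a C*-algebra $A$, let $C^*(G, A, \alpha)$ be the crossed product, and identify $A$ with its canonical image in $C^*(G, A, \alpha)$. (By stability $(P)$ is invariant under isomorphism, so $I_P(A)$ is $\alpha$-invariant, and $C^*(G, I_P(A), \alpha)$ is an ideal of $C^*(G, A, \alpha)$.) Then the following are equivalent: 1. Whenever $A$ is a C*-algebra with $(P)$ and $\alpha \colon G \to \mathrm{Aut}(A)$ is any action of $G$ on $A$, then $C^*(G, A, \alpha)$ also has $(P)$. 2. Whenever $A$ is a C*-algebra and $\alpha \colon G \to \mathrm{Aut}(A)$ is any action of $G$ on $A$, then $C^*(G, I_P(A), \alpha)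 \subseteq I_P(C^*(G, A, \alpha))$. 3. Whenever $A$ is a C*-algebra and $\alpha \colon G \to \mathrm{Aut}(A)$ is any action of $G$ on $A$, then $I_P(A) \subseteq I_P(C^*(G, A, \alpha)) \cap A$. 4. Whenever $A$ is a C*-algebra and $\alpha \colon G \to \mathrm{Aut}(A)$ is any action of $G$ on $A$, then $C^*(G, I_P(A), \alpha) = I_P(C^*(G, A, \alpha))$. 5. Whenever $A$ is a C*-algebra and $\alpha \colon G \to \mathrm{Aut}(A)$ is any action of $G$ on $A$, then $I_P(A) = I_P(C^*(G, A, \alpha)) \cap A$. -/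

import Mathlib

universe u v w

theorem exists_cfc_approx_unit {A : Type u} [NonUnitalCStarAlgebra A] (x : A) (n : ℕ) :
    ∃ f : ℝ → ℝ, ‖star x - star x * cfcₙ f (x * star x)‖ ^ 2 ≤ 1 / (n + 1 : ℝ) := by
  let _ : PartialOrder A := CStarAlgebra.spectralOrder A
  have _ : StarOrderedRing A := CStarAlgebra.spectralOrderedRing A
  obtain ⟨y, hy⟩ : ∃ y, y = x * star x := ⟨_, rfl⟩
  rw [← hy]
  have hysa : IsSelfAdjoint y := hy ▸ IsSelfAdjoint.mul_star_self x
  have hy0 : 0 ≤ y := hy ▸ mul_star_self_nonneg x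
  have hq : ∀ t ∈ quasispectrum ℝ y, 0 ≤ t := fun t ht => quasispectrum_nonneg_of_nonneg y hy0 t ht
  obtain ⟨f, hfdef⟩ : ∃ f : ℝ → ℝ, ∀ t, f t = (n + 1) * t / (1 + (n + 1) * t) :=
    ⟨_, fun _ => rfl⟩
  have hf : ContinuousOn f (quasispectrum ℝ y) := by
    rw [funext hfdef]
    refine ContinuousOn.div (by fun_prop) (by fun_prop) fun t ht => ?_
    have := hq t ht
    positivity
  have hf0 : f 0 = 0 := by simp [hfdef]
  refine ⟨f, ?_⟩
  have he' : star (cfcₙ f y) = cfcₙ f y := (cfcₙ_predicate f y : IsSelfAdjoint (cfcₙ f y))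
  rw [sq, ← CStarRing.norm_star_mul_self]
  have : star (star x - star x * cfcₙ f y) * (star x - star x * cfcₙ f y)
      = cfcₙ (fun t => t - t * f t - f t * t + f t * t * f t) y := by
    rw [cfcₙ_add (R := ℝ) (a := y) (fun t => t - t * f t - f t * t) (fun t => f t * t * f t),
      cfcₙ_sub (R := ℝ) (a := y) (fun t => t - t * f t) (fun t => f t * t),
      cfcₙ_sub (R := ℝ) (a := y) (fun t => t) (fun t => t * f t),
      cfcₙ_mul (R := ℝ) (a := y) (fun t => f t * t) f, cfcₙ_mul (R := ℝ) (a := y) f (fun t => t),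
      cfcₙ_mul (R := ℝ) (a := y) (fun t => t) f, cfcₙ_id' ℝ y]
    generalize cfcₙ f y = e at he'
    simp only [star_sub, star_mul, star_star, he', hy, mul_sub, sub_mul, mul_assoc]
    abel
  rw [this]
  refine norm_cfcₙ_le fun t ht => ?_
  have ht0 := hq t ht
  have : t - t * f t - f t * t + f t * t * f t = t / (1 + (n + 1) * t) ^ 2 := by
    simp only [hfdef]; field_simp; ring
  rw [this, Real.norm_of_nonneg (by positivity), div_le_div_iff₀ (by positivity) (by positivity)]
  nlinarith [mul_nonneg (Nat.cast_nonneg (α := ℝ) n) ht0, sq_nonneg ((n + 1) * t)]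

/-- Closed two-sided ideals of C*-algebras are self-adjoint. -/
theorem star_mem_of_isClosed_ideal {A : Type u} [NonUnitalCStarAlgebra A] (I : Submodule ℂ A)
    (hl : ∀ (a : A) {x : A}, x ∈ I → a * x ∈ I) (hr : ∀ (a : A) {x : A}, x ∈ I → x * a ∈ I)
    (hc : IsClosed (I : Set A)) {x : A} (hx : x ∈ I) : star x ∈ I := by
  let J : NonUnitalStarSubalgebra ℝ A :=
    { carrier := {y | y ∈ I ∧ star y ∈ I}
      add_mem' := fun {a b} ha hb => ⟨I.add_mem ha.1 hb.1, by
        rw [star_add]; exact I.add_mem ha.2 hb.2⟩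
      zero_mem' := ⟨I.zero_mem, by rw [star_zero]; exact I.zero_mem⟩
      mul_mem' := fun {a b} ha hb => ⟨hl _ hb.1, by rw [star_mul]; exact hl _ ha.2⟩
      smul_mem' := fun c {a} ha => ⟨I.smul_mem (c : ℂ) ha.1, by
        rw [star_smul]; exact I.smul_mem (c : ℂ) ha.2⟩
      star_mem' := fun {a} ha => ⟨ha.2, by rw [star_star]; exact ha.1⟩ }
  have hJ : IsClosed (J : Set A) := hc.inter (hc.preimage continuous_star)
  have hysa : star (x * star x) = x * star x := IsSelfAdjoint.mul_star_self x
  have hyJ : x * star x ∈ J := ⟨hr _ hx, by rw [hysa]; exact hr _ hx⟩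
  choose f hf using exists_cfc_approx_unit x
  have hmem : ∀ n, cfcₙ (f n) (x * star x) ∈ I := fun n =>
    (NonUnitalStarAlgebra.elemental.le_of_mem hJ hyJ (cfcₙ_mem_elemental (f n) (x * star x))).1
  have hlim : Filter.Tendsto (fun n => star x * cfcₙ (f n) (x * star x)) Filter.atTop
      (nhds (star x)) := by
    rw [tendsto_iff_norm_sub_tendsto_zero]
    have h1 : Filter.Tendsto (fun n => ‖star x * cfcₙ (f n) (x * star x) - star x‖ ^ 2)
        Filter.atTop (nhds 0) :=
      squeeze_zero (fun n => by positivity)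
        (fun n => by rw [norm_sub_rev]; exact hf n) tendsto_one_div_add_atTop_nhds_zero_nat
    have h2 := h1.sqrt
    simpa using h2
  exact hc.mem_of_tendsto hlim (Filter.Eventually.of_forall fun n => hl _ (hmem n))

/-- An ideal of a C*-algebra, in the sense of the theory of C*-algebras: a closed two-sided ideal
(which is, as an ideal of an algebra, a linear subspace).  Such an ideal is self-adjoint, and hence
itself a C*-algebra with the operations and the norm of the ambient algebra. -/
structure ClosedIdeal (A : Type u) [NonUnitalCStarAlgebra A] extends Submodule ℂ A where
  mul_mem_left' : ∀ (a : A) {x : A}, x ∈ carrier → a * x ∈ carrier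
  mul_mem_right' : ∀ (a : A) {x : A}, x ∈ carrier → x * a ∈ carrier
  isClosed' : IsClosed carrier

namespace ClosedIdeal

variable {A : Type u} [NonUnitalCStarAlgebra A]

instance : SetLike (ClosedIdeal A) A where
  coe I := I.carrier
  coe_injective := by
    rintro ⟨I, _, _, _⟩ ⟨J, _, _, _⟩ h
    have : I = J := SetLike.coe_injective h
    subst this
    rfl

instance : PartialOrder (ClosedIdeal A) := PartialOrder.ofSetLike (ClosedIdeal A) A

instance : NonUnitalSubringClass (ClosedIdeal A) A where
  add_mem {I} _ _ ha hb := I.toSubmodule.add_mem ha hb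
  zero_mem I := I.toSubmodule.zero_mem
  neg_mem {I} _ ha := I.toSubmodule.neg_mem ha
  mul_mem {I} a _ _ hb := I.mul_mem_left' a hb

instance : SMulMemClass (ClosedIdeal A) ℂ A where
  smul_mem {I} c _ ha := I.toSubmodule.smul_mem c ha

instance : StarMemClass (ClosedIdeal A) A where
  star_mem {I} _ ha :=
    star_mem_of_isClosed_ideal I.toSubmodule I.mul_mem_left' I.mul_mem_right' I.isClosed' ha

instance (I : ClosedIdeal A) : IsClosed (I : Set A) := I.isClosed'

end ClosedIdeal

/-- The Hilbert space `ℓ²(ℕ)`. -/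
abbrev HilbertSeq : Type := lp (fun _ : ℕ => ℂ) 2

/-- The C*-algebra `K` of compact operators on a separable infinite dimensional Hilbert space. -/
noncomputable def compactOperators : NonUnitalStarSubalgebra ℂ (HilbertSeq →L[ℂ] HilbertSeq) where
  carrier := {T | IsCompactOperator T}
  add_mem' := fun hS hT => IsCompactOperator.add hS hT
  zero_mem' := isCompactOperator_zero
  mul_mem' := fun {_ T} hS _ => IsCompactOperator.comp_clm hS T
  smul_mem' := fun c _ hT => IsCompactOperator.smul hT c
  star_mem' := fun hT =>
    star_mem_of_isClosed_ideal (compactOperator (RingHom.id ℂ) HilbertSeq HilbertSeq)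
      (fun S _ hT => IsCompactOperator.clm_comp hT S)
      (fun S _ hT => IsCompactOperator.comp_clm hT S)
      isClosed_setOfPred_isCompactOperator hT

instance : IsClosed (compactOperators : Set (HilbertSeq →L[ℂ] HilbertSeq)) :=
  isClosed_setOfPred_isCompactOperator

/-- The C*-algebra `K` as a type. -/
abbrev KAlg : Type := compactOperators

/-- The crossed product `C*(G, A, α)` of a C*-algebra `A` by an action `α` of a finite group `G`
by automorphisms.  Since `G` is finite, this is the *-algebra of all functions `G → A`
(`f` stands for `∑ g, f g • u_g`) with the twisted convolution and involution defined below,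
and no completion is needed. -/
def CrossedProduct {G : Type v} [Group G] {A : Type u} [NonUnitalCStarAlgebra A]
    (_α : G →* (A ≃⋆ₐ[ℂ] A)) : Type (max u v) := G → A

namespace CrossedProduct

variable {G : Type v} [Group G] {A : Type u} [NonUnitalCStarAlgebra A] (α : G →* (A ≃⋆ₐ[ℂ] A))

instance : FunLike (CrossedProduct α) G A where
  coe f := f
  coe_injective _ _ h := h

/-- Build an element of the crossed product from its coefficient function. -/
def ofFun (f : G → A) : CrossedProduct α := f

@[simp] theorem ofFun_apply (f : G → A) (s : G) : ofFun α f s = f s := rfl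

variable {α} in
@[ext] theorem ext {f g : CrossedProduct α} (h : ∀ s, f s = g s) : f = g := funext h

instance : AddCommGroup (CrossedProduct α) := inferInstanceAs (AddCommGroup (G → A))
noncomputable instance : Module ℂ (CrossedProduct α) := inferInstanceAs (Module ℂ (G → A))

@[simp] theorem zero_apply (s : G) : (0 : CrossedProduct α) s = 0 := rfl
@[simp] theorem add_apply (f g : CrossedProduct α) (s : G) : (f + g) s = f s + g s := rfl
@[simp] theorem smul_apply (c : ℂ) (f : CrossedProduct α) (s : G) : (c • f) s = c • f s := rfl

/-- The involution `f^*(s) = α_s(f(s⁻¹)^*)`. -/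
instance : Star (CrossedProduct α) := ⟨fun f => ofFun α fun s => α s (star (f s⁻¹))⟩

theorem star_apply (f : CrossedProduct α) (s : G) : star f s = α s (star (f s⁻¹)) := rfl

/-- The regular representation of the crossed product by `G × G` matrices over `A`. -/
def toMatrix (f : CrossedProduct α) : CStarMatrix G G A :=
  CStarMatrix.ofMatrix fun s t => α s⁻¹ (f (s * t⁻¹))

theorem toMatrix_apply (f : CrossedProduct α) (s t : G) :
    toMatrix α f s t = α s⁻¹ (f (s * t⁻¹)) := rfl

theorem toMatrix_injective : Function.Injective (toMatrix α) := by
  intro f g h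
  ext s
  have := congrFun (congrFun h 1) s⁻¹
  simpa [toMatrix_apply] using this

theorem toMatrix_add (f g : CrossedProduct α) : toMatrix α (f + g) = toMatrix α f + toMatrix α g :=
  CStarMatrix.ext fun s t => by simp [toMatrix_apply]

theorem toMatrix_smul (c : ℂ) (f : CrossedProduct α) : toMatrix α (c • f) = c • toMatrix α f :=
  CStarMatrix.ext fun s t => by simp [toMatrix_apply]

theorem toMatrix_star (f : CrossedProduct α) : toMatrix α (star f) = star (toMatrix α f) :=
  CStarMatrix.ext fun s t => by
    rw [CStarMatrix.star_apply, toMatrix_apply, toMatrix_apply, star_apply, ← map_star,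
      ← StarAlgEquiv.mul_apply, ← map_mul]
    simp

variable [Fintype G]

/-- The twisted convolution `(f * g)(s) = ∑ r, f(r) α_r(g(r⁻¹ s))`. -/
instance : Mul (CrossedProduct α) := ⟨fun f g => ofFun α fun s => ∑ r, f r * α r (g (r⁻¹ * s))⟩

theorem mul_apply (f g : CrossedProduct α) (s : G) :
    (f * g) s = ∑ r, f r * α r (g (r⁻¹ * s)) := rfl

theorem toMatrix_mul (f g : CrossedProduct α) : toMatrix α (f * g) = toMatrix α f * toMatrix α g :=
  CStarMatrix.ext fun s t => by
    rw [CStarMatrix.mul_apply, toMatrix_apply, mul_apply, map_sum]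
    refine Fintype.sum_equiv ((Equiv.inv G).trans (Equiv.mulRight s)) _ _ fun r => ?_
    simp only [toMatrix_apply, map_mul, ← StarAlgEquiv.mul_apply, Equiv.trans_apply,
      Equiv.inv_apply, Equiv.coe_mulRight]
    simp [mul_assoc]

instance : NonUnitalRing (CrossedProduct α) where
  left_distrib f g h := toMatrix_injective α <| by
    simp only [toMatrix_mul, toMatrix_add, mul_add]
  right_distrib f g h := toMatrix_injective α <| by
    simp only [toMatrix_mul, toMatrix_add, add_mul]
  zero_mul f := by ext s; simp [mul_apply]
  mul_zero f := by ext s; simp [mul_apply]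
  mul_assoc f g h := toMatrix_injective α <| by simp only [toMatrix_mul, mul_assoc]

instance : StarRing (CrossedProduct α) where
  star_involutive f := toMatrix_injective α <| by simp only [toMatrix_star, star_star]
  star_mul f g := toMatrix_injective α <| by simp only [toMatrix_star, toMatrix_mul, star_mul]
  star_add f g := toMatrix_injective α <| by simp only [toMatrix_star, toMatrix_add, star_add]

/-- The regular representation as a *-homomorphism. -/
def regularRep : CrossedProduct α →⋆ₙₐ[ℂ] CStarMatrix G G A where
  toFun := toMatrix α
  map_smul' := toMatrix_smul α
  map_zero' := CStarMatrix.ext fun s t => by simp [toMatrix_apply]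
  map_add' := toMatrix_add α
  map_mul' := toMatrix_mul α
  map_star' := toMatrix_star α

theorem isClosed_range_regularRep : IsClosed (Set.range (regularRep α)) := by
  have hα : ∀ s, Continuous (α s) := fun s =>
    (NonUnitalStarAlgHom.isometry (α s) (α s).injective).continuous
  have hc : ∀ s t, Continuous fun M : CStarMatrix G G A => M s t := fun s t =>
    (continuous_apply t).comp (continuous_apply (A := fun _ : G => G → A) s)
  have : Set.range (regularRep α) =
      {M : CStarMatrix G G A | ∀ s t, M s t = α s⁻¹ (M 1 (t * s⁻¹))} := by
    ext M
    constructor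
    · rintro ⟨f, rfl⟩ s t
      change α s⁻¹ (f (s * t⁻¹)) = α s⁻¹ (α 1⁻¹ (f (1 * (t * s⁻¹)⁻¹)))
      simp
    · intro hM
      refine ⟨ofFun α fun s => M 1 s⁻¹, CStarMatrix.ext fun s t => ?_⟩
      change α s⁻¹ (M 1 (s * t⁻¹)⁻¹) = M s t
      rw [hM s t]
      simp
  rw [this]
  simp only [Set.ofPred_forall]
  exact isClosed_iInter fun s => isClosed_iInter fun t =>
    isClosed_eq (hc s t) ((hα s⁻¹).comp (hc 1 (t * s⁻¹)))

/-- The C*-algebra structure of the crossed product; its norm is the norm of the regular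
representation.  It is the unique C*-norm on the convolution algebra; in particular it is the
universal one, see `norm_map_le`. -/
noncomputable instance : NonUnitalCStarAlgebra (CrossedProduct α) :=
  let _ : PartialOrder A := CStarAlgebra.spectralOrder A
  have _ : StarOrderedRing A := CStarAlgebra.spectralOrderedRing A
  let _ : NonUnitalNormedRing (CrossedProduct α) :=
    NonUnitalNormedRing.induced (CrossedProduct α) (CStarMatrix G G A) (regularRep α)
      (toMatrix_injective α)
  have hnorm : ∀ f : CrossedProduct α, ‖f‖ = ‖regularRep α f‖ := fun _ => rfl
  have hiso : Isometry (regularRep α) := AddMonoidHomClass.isometry_of_norm _ fun f => (hnorm f).symm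
  { norm_mul_self_le := fun f => by
      rw [hnorm, hnorm, map_mul, map_star, CStarRing.norm_star_mul_self]
    toCompleteSpace := by
      rw [completeSpace_iff_isComplete_range hiso.isUniformInducing]
      exact (isClosed_range_regularRep α).isComplete
    norm_smul_le := fun c f => by
      rw [hnorm, hnorm, map_smul]
      exact norm_smul_le _ _
    smul_assoc := fun c f g => toMatrix_injective α <| by
      simp only [smul_eq_mul, toMatrix_mul, toMatrix_smul, smul_mul_assoc]
    smul_comm := fun c f g => toMatrix_injective α <| by
      simp only [smul_eq_mul, toMatrix_mul, toMatrix_smul, mul_smul_comm]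
    star_smul := fun c f => toMatrix_injective α <| by
      simp only [toMatrix_star, toMatrix_smul, star_smul] }

/-- Every representation of the convolution algebra in a C*-algebra is contractive for the norm of
the crossed product: this norm is the universal C*-norm. -/
theorem norm_map_le {B : Type w} [NonUnitalCStarAlgebra B] (π : CrossedProduct α →⋆ₙₐ[ℂ] B)
    (f : CrossedProduct α) : ‖π f‖ ≤ ‖f‖ :=
  NonUnitalStarAlgHom.norm_apply_le π f

open Classical in
/-- The canonical inclusion of `A` in the crossed product, `a ↦ a u_1`. -/
noncomputable def incl : A →⋆ₙₐ[ℂ] CrossedProduct α where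
  toFun a := ofFun α (Pi.single 1 a)
  map_smul' c a := by
    ext s; by_cases h : s = 1
    · subst h; simp
    · simp [h]
  map_zero' := by ext s; simp
  map_add' a b := by ext s; simp [Pi.single_add]
  map_mul' a b := by
    ext s
    rw [mul_apply, Fintype.sum_eq_single 1 (fun r hr => by simp [hr])]
    by_cases h : s = 1
    · subst h; simp
    · simp [h]
  map_star' a := by
    ext s
    rw [star_apply]
    by_cases h : s = 1
    · subst h; simp
    · simp [h]

open Classical in
theorem incl_apply (a : A) (s : G) : incl α a s = if s = 1 then a else 0 := by
  simp [incl, Pi.single_apply]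

/-- The action on an invariant ideal `I` obtained by restricting `α`. -/
noncomputable def restrictAction (I : ClosedIdeal A) (hI : ∀ g, ∀ a ∈ I, α g a ∈ I) :
    G →* (I ≃⋆ₐ[ℂ] I) where
  toFun g :=
    { toFun := fun a => ⟨α g a, hI g a a.2⟩
      invFun := fun a => ⟨α g⁻¹ a, hI g⁻¹ a a.2⟩
      left_inv := fun a => Subtype.ext <| by
        change α g⁻¹ (α g a) = a
        rw [← StarAlgEquiv.mul_apply, ← map_mul]; simp
      right_inv := fun a => Subtype.ext <| by
        change α g (α g⁻¹ a) = a
        rw [← StarAlgEquiv.mul_apply, ← map_mul]; simp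
      map_mul' := fun a b => Subtype.ext (map_mul (α g) (a : A) b)
      map_add' := fun a b => Subtype.ext (map_add (α g) (a : A) b)
      map_star' := fun a => Subtype.ext (map_star (α g) (a : A))
      map_smul' := fun c a => Subtype.ext (map_smul (α g) c (a : A)) }
  map_one' := by ext a; change α 1 (a : A) = a; simp
  map_mul' g h := by ext a; change α (g * h) (a : A) = α g (α h a); simp

/-- For an `α`-invariant ideal `I` of `A`, the subset `C*(G, I, α)` of `C*(G, A, α)`: the functions
with values in `I`. By `range_ofIdealHom` it is the image of the crossed product of `I` by the
restricted action under its canonical inclusion. -/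
def ofIdeal (I : ClosedIdeal A) : Set (CrossedProduct α) := {f | ∀ s, f s ∈ I}

/-- The canonical inclusion of the crossed product by the restricted action on an invariant
ideal. -/
noncomputable def ofIdealHom (I : ClosedIdeal A) (hI : ∀ g, ∀ a ∈ I, α g a ∈ I) :
    CrossedProduct (restrictAction α I hI) →⋆ₙₐ[ℂ] CrossedProduct α where
  toFun f := ofFun α fun s => (f s : A)
  map_smul' _ _ := rfl
  map_zero' := rfl
  map_add' _ _ := rfl
  map_mul' f g := by
    ext s
    rw [ofFun_apply, mul_apply, mul_apply, AddSubmonoidClass.coe_finsetSum]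
    rfl
  map_star' _ := rfl

theorem range_ofIdealHom (I : ClosedIdeal A) (hI : ∀ g, ∀ a ∈ I, α g a ∈ I) :
    Set.range (ofIdealHom α I hI) = ofIdeal α I := by
  ext f
  constructor
  · rintro ⟨f, rfl⟩ s
    exact (f s).2
  · intro hf
    exact ⟨ofFun _ fun s => ⟨f s, hf s⟩, rfl⟩

end CrossedProduct

/-- A representation of a *-algebra: a *-homomorphism to a C*-algebra. -/
structure CStarRep (X : Type u) [NonUnitalRing X] [StarRing X] [Module ℂ X] where
  /-- The C*-algebra in which the *-algebra is represented. -/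
  B : Type u
  [inst : NonUnitalCStarAlgebra B]
  /-- The *-homomorphism. -/
  hom : X →⋆ₙₐ[ℂ] B

attribute [instance] CStarRep.inst

/-- The *-algebra `X` has a universal C*-seminorm: the norms of the images of each element under
all representations are bounded. -/
class BoundedReps (X : Type u) [NonUnitalRing X] [StarRing X] [Module ℂ X] : Prop where
  bddAbove : ∀ x : X, BddAbove (Set.range fun ρ : CStarRep X => ‖ρ.hom x‖)

/-- A copy of the *-algebra `X`, to carry its universal C*-seminorm. -/
def UnivNormed (X : Type u) : Type u := X

namespace UnivNormed

variable (X : Type u) [NonUnitalRing X] [StarRing X] [Module ℂ X]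

instance : NonUnitalRing (UnivNormed X) := inferInstanceAs (NonUnitalRing X)
instance : StarRing (UnivNormed X) := inferInstanceAs (StarRing X)
instance : Module ℂ (UnivNormed X) := inferInstanceAs (Module ℂ X)
instance [IsScalarTower ℂ X X] : IsScalarTower ℂ (UnivNormed X) (UnivNormed X) :=
  inferInstanceAs (IsScalarTower ℂ X X)
instance [SMulCommClass ℂ X X] : SMulCommClass ℂ (UnivNormed X) (UnivNormed X) :=
  inferInstanceAs (SMulCommClass ℂ X X)
instance [StarModule ℂ X] : StarModule ℂ (UnivNormed X) := inferInstanceAs (StarModule ℂ X)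
instance [h : BoundedReps X] : BoundedReps (UnivNormed X) := h

/-- The universal C*-seminorm: the supremum of `‖π x‖` over all *-homomorphisms `π` to
C*-algebras. -/
noncomputable instance : Norm (UnivNormed X) := ⟨fun x => ⨆ ρ : CStarRep X, ‖ρ.hom x‖⟩

theorem norm_def (x : UnivNormed X) :
    ‖x‖ = ⨆ ρ : CStarRep (UnivNormed X), ‖ρ.hom x‖ := rfl

theorem norm_nonneg' (x : UnivNormed X) : 0 ≤ ‖x‖ :=
  Real.iSup_nonneg fun _ => norm_nonneg _

theorem norm_star' (x : UnivNormed X) : ‖star x‖ = ‖x‖ := by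
  rw [norm_def, norm_def]
  exact congrArg _ (funext fun ρ => by rw [map_star, norm_star])

variable [BoundedReps X]

theorem le_norm (ρ : CStarRep (UnivNormed X)) (x : UnivNormed X) : ‖ρ.hom x‖ ≤ ‖x‖ :=
  le_ciSup (BoundedReps.bddAbove (X := UnivNormed X) x) ρ

noncomputable instance : SeminormedAddCommGroup (UnivNormed X) :=
  AddGroupSeminorm.toSeminormedAddCommGroup
    { toFun := fun x : UnivNormed X => ‖x‖
      map_zero' := by rw [norm_def]; simp
      add_le' := fun x y => Real.iSup_le
        (fun ρ : CStarRep (UnivNormed X) => by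
          change ‖ρ.hom (x + y : UnivNormed X)‖ ≤ _
          rw [map_add]
          exact (norm_add_le _ _).trans (add_le_add (le_norm X ρ x) (le_norm X ρ y)))
        (add_nonneg (norm_nonneg' X x) (norm_nonneg' X y))
      neg' := fun x => by
        rw [norm_def, norm_def]
        exact congrArg _ (funext fun ρ => by rw [map_neg, norm_neg]) }

noncomputable instance : NonUnitalSeminormedRing (UnivNormed X) where
  dist_eq := SeminormedAddGroup.dist_eq
  norm_mul_le x y := Real.iSup_le
    (fun ρ : CStarRep (UnivNormed X) => by
      change ‖ρ.hom (x * y : UnivNormed X)‖ ≤ _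
      rw [map_mul]
      exact (norm_mul_le _ _).trans
        (mul_le_mul (le_norm X ρ x) (le_norm X ρ y) (norm_nonneg _) (norm_nonneg' X x)))
    (mul_nonneg (norm_nonneg' X x) (norm_nonneg' X y))

noncomputable instance : NormedSpace ℂ (UnivNormed X) where
  norm_smul_le c x := Real.iSup_le
    (fun ρ : CStarRep (UnivNormed X) => by
      change ‖ρ.hom (c • x : UnivNormed X)‖ ≤ _
      rw [map_smul, norm_smul]
      exact mul_le_mul_of_nonneg_left (le_norm X ρ x) (norm_nonneg c))
    (mul_nonneg (norm_nonneg c) (norm_nonneg' X x))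

theorem norm_mul_self_le (x : UnivNormed X) : ‖x‖ * ‖x‖ ≤ ‖star x * x‖ := by
  rw [← sq]
  refine (Real.le_sqrt (norm_nonneg' X x) (norm_nonneg' X _)).mp ?_
  refine Real.iSup_le (fun ρ => Real.le_sqrt_of_sq_le ?_) (Real.sqrt_nonneg _)
  rw [sq, ← CStarRing.norm_star_mul_self]
  have := le_norm X ρ (star x * x)
  rwa [map_mul, map_star] at this

theorem isometry_star : Isometry (star : UnivNormed X → UnivNormed X) :=
  Isometry.of_dist_eq fun x y => by
    rw [dist_eq_norm, dist_eq_norm, ← star_sub, norm_star']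

end UnivNormed

/-- The enveloping C*-algebra of the *-algebra `X`: the Hausdorff completion of `X` with respect
to its universal C*-seminorm. -/
def CStarEnvelope (X : Type u) [NonUnitalRing X] [StarRing X] [Module ℂ X] [BoundedReps X] :
    Type u :=
  UniformSpace.Completion (UnivNormed X)

namespace CStarEnvelope

open UniformSpace

variable (X : Type u) [NonUnitalRing X] [StarRing X] [Module ℂ X] [BoundedReps X]

noncomputable instance : NormedAddCommGroup (CStarEnvelope X) :=
  inferInstanceAs (NormedAddCommGroup (Completion (UnivNormed X)))
noncomputable instance : NormedSpace ℂ (CStarEnvelope X) :=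
  inferInstanceAs (NormedSpace ℂ (Completion (UnivNormed X)))
instance : CompleteSpace (CStarEnvelope X) :=
  inferInstanceAs (CompleteSpace (Completion (UnivNormed X)))

/-- The canonical map of `X` to its enveloping C*-algebra. -/
noncomputable def ofUniv (x : UnivNormed X) : CStarEnvelope X := (x : Completion (UnivNormed X))

theorem denseRange_ofUniv : DenseRange (ofUniv X) := Completion.denseRange_coe
theorem norm_ofUniv (x : UnivNormed X) : ‖ofUniv X x‖ = ‖x‖ := Completion.norm_coe x
theorem ofUniv_add (x y : UnivNormed X) : ofUniv X (x + y) = ofUniv X x + ofUniv X y :=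
  Completion.coe_add x y
theorem ofUniv_zero : ofUniv X 0 = 0 := Completion.coe_zero
theorem ofUniv_smul (c : ℂ) (x : UnivNormed X) : ofUniv X (c • x) = c • ofUniv X x :=
  Completion.coe_smul c x

variable {X} in
theorem eq₁ {f g : CStarEnvelope X → CStarEnvelope X} (hf : Continuous f) (hg : Continuous g)
    (h : ∀ x, f (ofUniv X x) = g (ofUniv X x)) (a : CStarEnvelope X) : f a = g a :=
  congrFun ((denseRange_ofUniv X).equalizer hf hg (funext h)) a

variable {X} in
theorem eq₂ {f g : CStarEnvelope X → CStarEnvelope X → CStarEnvelope X}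
    (hf : Continuous fun p : CStarEnvelope X × CStarEnvelope X => f p.1 p.2)
    (hg : Continuous fun p : CStarEnvelope X × CStarEnvelope X => g p.1 p.2)
    (h : ∀ x y, f (ofUniv X x) (ofUniv X y) = g (ofUniv X x) (ofUniv X y))
    (a b : CStarEnvelope X) : f a b = g a b :=
  (denseRange_ofUniv X).induction_on₂ (p := fun a b => f a b = g a b) (isClosed_eq hf hg) h a b

variable {X} in
theorem eq₃ {f g : CStarEnvelope X → CStarEnvelope X → CStarEnvelope X → CStarEnvelope X}
    (hf : Continuous fun p : CStarEnvelope X × CStarEnvelope X × CStarEnvelope X =>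
      f p.1 p.2.1 p.2.2)
    (hg : Continuous fun p : CStarEnvelope X × CStarEnvelope X × CStarEnvelope X =>
      g p.1 p.2.1 p.2.2)
    (h : ∀ x y z, f (ofUniv X x) (ofUniv X y) (ofUniv X z) =
      g (ofUniv X x) (ofUniv X y) (ofUniv X z))
    (a b c : CStarEnvelope X) : f a b c = g a b c :=
  (denseRange_ofUniv X).induction_on₃ (p := fun a b c => f a b c = g a b c)
    (isClosed_eq hf hg) h a b c

/-- Multiplication, extended from `X` by continuity. -/
noncomputable instance : Mul (CStarEnvelope X) :=
  ⟨Function.curry <| ((Completion.isDenseInducing_coe (α := UnivNormed X)).prodMap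
    (Completion.isDenseInducing_coe (α := UnivNormed X))).extend
      (ofUniv X ∘ Function.uncurry (· * ·))⟩

/-- Involution, extended from `X` by continuity. -/
noncomputable instance : Star (CStarEnvelope X) :=
  ⟨Completion.map (star : UnivNormed X → UnivNormed X)⟩

theorem ofUniv_mul (x y : UnivNormed X) : ofUniv X (x * y) = ofUniv X x * ofUniv X y :=
  (((Completion.isDenseInducing_coe (α := UnivNormed X)).prodMap
    (Completion.isDenseInducing_coe (α := UnivNormed X))).extend_eq
      ((Completion.continuous_coe (UnivNormed X)).comp continuous_mul) (x, y)).symm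

theorem ofUniv_star (x : UnivNormed X) : ofUniv X (star x) = star (ofUniv X x) :=
  (Completion.map_coe (UnivNormed.isometry_star X).uniformContinuous x).symm

instance : ContinuousMul (CStarEnvelope X) where
  continuous_mul := by
    let m := (AddMonoidHom.mul : UnivNormed X →+ UnivNormed X →+ UnivNormed X).compr₂
      Completion.toCompl
    have : Continuous fun p : UnivNormed X × UnivNormed X => m p.1 p.2 :=
      (Completion.continuous_coe _).comp continuous_mul
    have di : IsDenseInducing (Completion.toCompl : UnivNormed X → Completion (UnivNormed X)) :=
      Completion.isDenseInducing_coe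
    exact (di.extend_Z_bilin di this :)

instance : ContinuousStar (CStarEnvelope X) where
  continuous_star := Completion.continuous_map

noncomputable instance : NonUnitalRing (CStarEnvelope X) where
  zero_mul := eq₁ (f := fun a => 0 * a) (g := fun _ => 0) (by fun_prop) (by fun_prop) fun x => by
    rw [← ofUniv_zero, ← ofUniv_mul, zero_mul]
  mul_zero := eq₁ (f := fun a => a * 0) (g := fun _ => 0) (by fun_prop) (by fun_prop) fun x => by
    rw [← ofUniv_zero, ← ofUniv_mul, mul_zero]
  mul_assoc := eq₃ (f := fun a b c => a * b * c) (g := fun a b c => a * (b * c))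
    (by fun_prop) (by fun_prop) fun x y z => by simp only [← ofUniv_mul, mul_assoc]
  left_distrib := eq₃ (f := fun a b c => a * (b + c)) (g := fun a b c => a * b + a * c)
    (by fun_prop) (by fun_prop) fun x y z => by simp only [← ofUniv_mul, ← ofUniv_add, mul_add]
  right_distrib := eq₃ (f := fun a b c => (a + b) * c) (g := fun a b c => a * c + b * c)
    (by fun_prop) (by fun_prop) fun x y z => by simp only [← ofUniv_mul, ← ofUniv_add, add_mul]

noncomputable instance : StarRing (CStarEnvelope X) where
  star_involutive := eq₁ (f := fun a => star (star a)) (g := fun a => a)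
    (by fun_prop) (by fun_prop) fun x => by simp only [← ofUniv_star, star_star]
  star_mul := eq₂ (f := fun a b => star (a * b)) (g := fun a b => star b * star a)
    (by fun_prop) (by fun_prop) fun x y => by simp only [← ofUniv_star, ← ofUniv_mul, star_mul]
  star_add := eq₂ (f := fun a b => star (a + b)) (g := fun a b => star a + star b)
    (by fun_prop) (by fun_prop) fun x y => by simp only [← ofUniv_star, ← ofUniv_add, star_add]

noncomputable instance : NonUnitalNormedRing (CStarEnvelope X) where
  dist_eq := NormedAddCommGroup.dist_eq
  norm_mul_le := (denseRange_ofUniv X).induction_on₂ (p := fun a b => ‖a * b‖ ≤ ‖a‖ * ‖b‖)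
    (isClosed_le (by fun_prop) (by fun_prop)) fun x y => by
      rw [← ofUniv_mul, norm_ofUniv, norm_ofUniv, norm_ofUniv]
      exact norm_mul_le x y

theorem smul_mul' [IsScalarTower ℂ X X] (c : ℂ) :
    ∀ a b : CStarEnvelope X, c • a * b = c • (a * b) :=
  eq₂ (f := fun a b => c • a * b) (g := fun a b => c • (a * b))
    ((continuous_fst.const_smul c).mul continuous_snd)
    ((continuous_fst.mul continuous_snd).const_smul c) fun x y => by
      simp only [← ofUniv_mul, ← ofUniv_smul, smul_mul_assoc]

theorem mul_smul' [SMulCommClass ℂ X X] (c : ℂ) :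
    ∀ a b : CStarEnvelope X, c • (a * b) = a * c • b :=
  eq₂ (f := fun a b => c • (a * b)) (g := fun a b => a * c • b)
    ((continuous_fst.mul continuous_snd).const_smul c)
    (continuous_fst.mul (continuous_snd.const_smul c)) fun x y => by
      simp only [← ofUniv_mul, ← ofUniv_smul, mul_smul_comm]

theorem star_smul' [StarModule ℂ X] (c : ℂ) :
    ∀ a : CStarEnvelope X, star (c • a) = star c • star a :=
  eq₁ (f := fun a => star (c • a)) (g := fun a => star c • star a)
    (continuous_id.const_smul c).star (continuous_star.const_smul (star c)) fun x => by
      simp only [← ofUniv_star, ← ofUniv_smul, star_smul]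

theorem norm_mul_self_le' (a : CStarEnvelope X) : ‖a‖ * ‖a‖ ≤ ‖star a * a‖ :=
  (denseRange_ofUniv X).induction_on (p := fun a => ‖a‖ * ‖a‖ ≤ ‖star a * a‖)
    a (isClosed_le (continuous_norm.mul continuous_norm)
      (continuous_star.mul continuous_id).norm) fun x => by
      rw [← ofUniv_star, ← ofUniv_mul, norm_ofUniv, norm_ofUniv]
      exact UnivNormed.norm_mul_self_le X x

noncomputable instance [IsScalarTower ℂ X X] [SMulCommClass ℂ X X] [StarModule ℂ X] :
    NonUnitalCStarAlgebra (CStarEnvelope X) where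
  norm_mul_self_le := norm_mul_self_le' X
  norm_smul_le := norm_smul_le
  smul_assoc := smul_mul' X
  smul_comm := mul_smul' X
  star_smul := star_smul' X

end CStarEnvelope

open scoped TensorProduct

section Tensor

variable {A : Type u} {B : Type v} [NonUnitalCStarAlgebra A] [NonUnitalCStarAlgebra B]

/-- The algebraic tensor product of C*-algebras is a *-algebra with
`(a ⊗ b)^* = a^* ⊗ b^*`. -/
noncomputable instance TensorProduct.starRingCStar : StarRing (A ⊗[ℂ] B) where
  star_add := star_add
  star_mul x y := by
    induction x with
    | zero => simp
    | add x x' hx hx' => simp only [add_mul, star_add, hx, hx', mul_add]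
    | tmul a b =>
      induction y with
      | zero => simp
      | add y y' hy hy' => simp only [add_mul, star_add, hy, hy', mul_add]
      | tmul c d => simp [TensorProduct.star_tmul, Algebra.TensorProduct.tmul_mul_tmul]

theorem exists_bound_left {C : Type w} [NonUnitalCStarAlgebra C] (π : A ⊗[ℂ] B →⋆ₙₐ[ℂ] C) (b : B) :
    ∃ M : ℝ, ∀ a : A, ‖π (a ⊗ₜ b)‖ ≤ M * ‖a‖ := by
  let _ : PartialOrder A := CStarAlgebra.spectralOrder A
  have _ : StarOrderedRing A := CStarAlgebra.spectralOrderedRing A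
  let _ : PartialOrder C := CStarAlgebra.spectralOrder C
  have _ : StarOrderedRing C := CStarAlgebra.spectralOrderedRing C
  let φ : A →ₗ[ℂ] C :=
    { toFun := fun a => π (a ⊗ₜ (star b * b))
      map_add' := fun a a' => by rw [TensorProduct.add_tmul, map_add]
      map_smul' := fun c a => by rw [← TensorProduct.smul_tmul', map_smul]; rfl }
  have hφ : ∀ a, ‖π (a ⊗ₜ b)‖ ^ 2 = ‖φ (star a * a)‖ := fun a => by
    rw [sq, ← CStarRing.norm_star_mul_self, ← map_star, ← map_mul, TensorProduct.star_tmul,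
      Algebra.TensorProduct.tmul_mul_tmul]
    rfl
  obtain ⟨M, hM⟩ := PositiveLinearMap.exists_norm_apply_le (PositiveLinearMap.mk₀ φ fun a ha => by
    obtain ⟨d, rfl⟩ := CStarAlgebra.nonneg_iff_eq_star_mul_self.mp ha
    have : φ (star d * d) = star (π (d ⊗ₜ b)) * π (d ⊗ₜ b) := by
      rw [← map_star, ← map_mul, TensorProduct.star_tmul, Algebra.TensorProduct.tmul_mul_tmul]
      rfl
    rw [this]
    exact star_mul_self_nonneg _)
  refine ⟨√(M : ℝ), fun a => ?_⟩
  refine le_of_sq_le_sq ?_ (by positivity)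
  rw [hφ, mul_pow, Real.sq_sqrt M.coe_nonneg, sq ‖a‖, ← CStarRing.norm_star_mul_self]
  exact hM _


theorem exists_bound_right {C : Type w} [NonUnitalCStarAlgebra C] (π : A ⊗[ℂ] B →⋆ₙₐ[ℂ] C) (a : A) :
    ∃ M : ℝ, ∀ b : B, ‖π (a ⊗ₜ b)‖ ≤ M * ‖b‖ := by
  let _ : PartialOrder B := CStarAlgebra.spectralOrder B
  have _ : StarOrderedRing B := CStarAlgebra.spectralOrderedRing B
  let _ : PartialOrder C := CStarAlgebra.spectralOrder C
  have _ : StarOrderedRing C := CStarAlgebra.spectralOrderedRing C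
  let φ : B →ₗ[ℂ] C :=
    { toFun := fun b => π ((star a * a) ⊗ₜ b)
      map_add' := fun b b' => by rw [TensorProduct.tmul_add, map_add]
      map_smul' := fun c b => by rw [TensorProduct.tmul_smul, map_smul]; rfl }
  have hφ : ∀ b, ‖π (a ⊗ₜ b)‖ ^ 2 = ‖φ (star b * b)‖ := fun b => by
    rw [sq, ← CStarRing.norm_star_mul_self, ← map_star, ← map_mul, TensorProduct.star_tmul,
      Algebra.TensorProduct.tmul_mul_tmul]
    rfl
  obtain ⟨M, hM⟩ := PositiveLinearMap.exists_norm_apply_le (PositiveLinearMap.mk₀ φ fun b hb => by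
    obtain ⟨d, rfl⟩ := CStarAlgebra.nonneg_iff_eq_star_mul_self.mp hb
    have : φ (star d * d) = star (π (a ⊗ₜ d)) * π (a ⊗ₜ d) := by
      rw [← map_star, ← map_mul, TensorProduct.star_tmul, Algebra.TensorProduct.tmul_mul_tmul]
      rfl
    rw [this]
    exact star_mul_self_nonneg _)
  refine ⟨√(M : ℝ), fun b => ?_⟩
  refine le_of_sq_le_sq ?_ (by positivity)
  rw [hφ, mul_pow, Real.sq_sqrt M.coe_nonneg, sq ‖b‖, ← CStarRing.norm_star_mul_self]
  exact hM _

theorem exists_bound {C : Type w} [NonUnitalCStarAlgebra C] (π : A ⊗[ℂ] B →⋆ₙₐ[ℂ] C) :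
    ∃ M : ℝ, 0 < M ∧ ∀ (a : A) (b : B), ‖π (a ⊗ₜ b)‖ ≤ M * (‖a‖ * ‖b‖) := by
  choose R hR using exists_bound_right π
  choose L hL using exists_bound_left π
  let g : Metric.closedBall (0 : A) 1 → B →L[ℂ] C := fun a =>
    LinearMap.mkContinuous
      { toFun := fun b => π ((a : A) ⊗ₜ b)
        map_add' := fun b b' => by rw [TensorProduct.tmul_add, map_add]
        map_smul' := fun c b => by rw [TensorProduct.tmul_smul, map_smul]; rfl } (R a) (hR a)
  obtain ⟨M, hM⟩ := banach_steinhaus (g := g) fun b => ⟨|L b|, fun a => by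
    change ‖π ((a : A) ⊗ₜ b)‖ ≤ _
    have ha : ‖(a : A)‖ ≤ 1 := mem_closedBall_zero_iff.mp a.2
    calc ‖π ((a : A) ⊗ₜ b)‖ ≤ L b * ‖(a : A)‖ := hL b a
      _ ≤ |L b| * 1 := mul_le_mul (le_abs_self _) ha (norm_nonneg _) (abs_nonneg _)
      _ = |L b| := mul_one _⟩
  refine ⟨|M| + 1, by positivity, fun a b => ?_⟩
  by_cases ha : a = 0
  · simp [ha]
  have hna : 0 < ‖a‖ := norm_pos_iff.mpr ha
  let u : Metric.closedBall (0 : A) 1 := ⟨((‖a‖⁻¹ : ℝ) : ℂ) • a, by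
    simp [norm_smul, inv_mul_cancel₀ hna.ne']⟩
  have h1 : ‖π ((u : A) ⊗ₜ b)‖ ≤ M * ‖b‖ := (g u).le_of_opNorm_le (hM u) b
  have h2 : π ((u : A) ⊗ₜ b) = ((‖a‖⁻¹ : ℝ) : ℂ) • π (a ⊗ₜ b) := by
    rw [← map_smul, TensorProduct.smul_tmul']
  rw [h2, norm_smul, Complex.norm_real, norm_inv, norm_norm, inv_mul_le_iff₀ hna] at h1
  calc ‖π (a ⊗ₜ b)‖ ≤ ‖a‖ * (M * ‖b‖) := h1
    _ = M * (‖a‖ * ‖b‖) := by ring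
    _ ≤ (|M| + 1) * (‖a‖ * ‖b‖) := by
      gcongr
      linarith [le_abs_self M]

/-- Every *-homomorphism from the algebraic tensor product of two C*-algebras to a C*-algebra is
contractive on elementary tensors. -/
theorem norm_map_tmul_le {C : Type w} [NonUnitalCStarAlgebra C] (π : A ⊗[ℂ] B →⋆ₙₐ[ℂ] C)
    (a : A) (b : B) : ‖π (a ⊗ₜ b)‖ ≤ ‖a‖ * ‖b‖ := by
  obtain ⟨M, hM0, hM⟩ := exists_bound π
  have key : ∀ (n : ℕ) (a : A) (b : B), ‖π (a ⊗ₜ b)‖ ^ 2 ^ n ≤ M * (‖a‖ * ‖b‖) ^ 2 ^ n := by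
    intro n
    induction n with
    | zero => intro a b; simpa using hM a b
    | succ n ih =>
      intro a b
      have h := ih (star a * a) (star b * b)
      rw [← Algebra.TensorProduct.tmul_mul_tmul, ← TensorProduct.star_tmul, map_mul, map_star,
        CStarRing.norm_star_mul_self, CStarRing.norm_star_mul_self,
        CStarRing.norm_star_mul_self] at h
      calc ‖π (a ⊗ₜ b)‖ ^ 2 ^ (n + 1) = (‖π (a ⊗ₜ b)‖ * ‖π (a ⊗ₜ b)‖) ^ 2 ^ n := by
            rw [← sq, ← pow_mul, pow_succ' 2 n]
        _ ≤ M * (‖a‖ * ‖a‖ * (‖b‖ * ‖b‖)) ^ 2 ^ n := h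
        _ = M * (‖a‖ * ‖b‖) ^ 2 ^ (n + 1) := by
            rw [pow_succ' 2 n, pow_mul (‖a‖ * ‖b‖), sq]; ring_nf
  by_contra! hlt
  have h0 : 0 ≤ ‖a‖ * ‖b‖ := by positivity
  rcases h0.eq_or_lt with h0 | h0
  · have := hM a b
    rw [← h0] at this hlt
    linarith
  · have hr : 1 < ‖π (a ⊗ₜ b)‖ / (‖a‖ * ‖b‖) := (one_lt_div h0).mpr hlt
    obtain ⟨n, hn⟩ := pow_unbounded_of_one_lt M hr
    have h3 : ‖π (a ⊗ₜ b)‖ ^ 2 ^ n / (‖a‖ * ‖b‖) ^ 2 ^ n ≤ M :=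
      (div_le_iff₀ (by positivity)).mpr (key n a b)
    rw [← div_pow] at h3
    have h4 := pow_le_pow_right₀ hr.le (Nat.lt_two_pow_self (n := n)).le
    linarith

instance : BoundedReps (A ⊗[ℂ] B) where
  bddAbove x := by
    suffices h : ∃ M, ∀ ρ : CStarRep (A ⊗[ℂ] B), ‖ρ.hom x‖ ≤ M by
      obtain ⟨M, hM⟩ := h
      exact ⟨M, by rintro _ ⟨ρ, rfl⟩; exact hM ρ⟩
    induction x with
    | zero => exact ⟨0, fun ρ => by simp⟩
    | tmul a b => exact ⟨‖a‖ * ‖b‖, fun ρ => norm_map_tmul_le ρ.hom a b⟩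
    | add x y hx hy =>
      obtain ⟨M, hM⟩ := hx
      obtain ⟨N, hN⟩ := hy
      exact ⟨M + N, fun ρ => by
        rw [map_add]
        exact (norm_add_le _ _).trans (add_le_add (hM ρ) (hN ρ))⟩

end Tensor

/-- The C*-tensor product `K ⊗ A`: the completion of the algebraic tensor product for the largest
C*-norm. (Since `K` is nuclear, it is the only C*-norm on the algebraic tensor product.) -/
abbrev Stabilization (A : Type u) [NonUnitalCStarAlgebra A] : Type u :=
  CStarEnvelope (KAlg ⊗[ℂ] A)

/-- A property that a C*-algebra may or may not have. -/
abbrev CStarProperty : Type (u + 1) := ∀ (A : Type u) [NonUnitalCStarAlgebra A], Prop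

/-- The property passes to stably isomorphic C*-algebras. -/
def IsStableProperty (P : CStarProperty.{u}) : Prop :=
  ∀ (A B : Type u) [NonUnitalCStarAlgebra A] [NonUnitalCStarAlgebra B],
    P A → Nonempty (Stabilization B ≃⋆ₐ[ℂ] Stabilization A) → P B

/-- Every C*-algebra has a largest ideal with the property. -/
def AdmitsLargestIdeals (P : CStarProperty.{u}) : Prop :=
  ∀ (A : Type u) [NonUnitalCStarAlgebra A],
    ∃ I : ClosedIdeal A, P I ∧ ∀ J : ClosedIdeal A, P J → J ≤ I

/-- The largest ideal of `A` with the property `P`. -/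
noncomputable def largestIdeal {P : CStarProperty.{u}} (hP : AdmitsLargestIdeals P)
    (A : Type u) [NonUnitalCStarAlgebra A] : ClosedIdeal A :=
  (hP A).choose

/-! Stability makes `(P)` pass from a matrix algebra over `A` to `A`. Indeed `K ⊗ M_n(A) ≅ K ⊗ A`,
because `ℓ²(ℕ)` is an orthogonal sum of `n` copies of itself (`nonempty_stabilization_equiv`). The
case `n = 1` gives invariance under isomorphism, so `I_P(A)` is invariant under automorphisms. Every
closed ideal of `M_n(A)` consists of the matrices over a closed ideal of `A`, hence the entries of
`I_P(M_n(A))` lie in `I_P(A)` (`entry_mem_largestIdeal`).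

The equivalence of 1, 2 and 3 is then formal, apart from an approximate unit argument for 3 → 2. The
core is 2 → 4: the inclusion in 2, assumed for all actions of `G`, forces its own converse. Since
`G` is finite abelian it is isomorphic to its dual, so the dual action on `C*(G, A, α)` is again an
action of `G`, and 2 applies to it. If `f` lies in `I_P(C*(G, A, α))`, its canonical image lies in
the largest ideal of the double crossed product. Takai duality (`takaiEquiv`) identifies the latter
with the `G × G` matrices over `A`, and the image of `f` becomes its regular representation
(`takaiFun_incl`). Its entries therefore lie in `I_P(A)`, and the values of `f` are among them. -/

/-! ### Functoriality of the enveloping C*-algebra. -/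

namespace CStarEnvelope

variable {X Y : Type u} [NonUnitalRing X] [StarRing X] [Module ℂ X] [BoundedReps X]
  [NonUnitalRing Y] [StarRing Y] [Module ℂ Y] [BoundedReps Y]

-- Composing a representation of `Y` with `φ` gives a representation of `X`, so the supremum for `φ
-- x` runs over part of the one for `x`. Universal norms are thus intrinsic to the *-algebra, and an
-- algebraic *-isomorphism of tensor products suffices for an isomorphism of stabilizations.
omit [BoundedReps Y] in
theorem norm_map_univ_le (φ : UnivNormed X →⋆ₙₐ[ℂ] UnivNormed Y) (x : UnivNormed X) :
    ‖φ x‖ ≤ ‖x‖ :=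
  Real.iSup_le (fun ρ : CStarRep (UnivNormed Y) =>
    UnivNormed.le_norm X ⟨ρ.B, ρ.hom.comp φ⟩ x) (UnivNormed.norm_nonneg' X x)

theorem uniformContinuous_univ (φ : UnivNormed X →⋆ₙₐ[ℂ] UnivNormed Y) : UniformContinuous φ :=
  (AddMonoidHomClass.lipschitz_of_bound φ 1 fun x => by
    rw [one_mul]; exact norm_map_univ_le φ x).uniformContinuous

/-- Functoriality of the enveloping C*-algebra, as a map. -/
noncomputable def map (φ : UnivNormed X →⋆ₙₐ[ℂ] UnivNormed Y) : CStarEnvelope X → CStarEnvelope Y :=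
  UniformSpace.Completion.map (φ)

theorem continuous_map (φ : UnivNormed X →⋆ₙₐ[ℂ] UnivNormed Y) : Continuous (map φ) :=
  UniformSpace.Completion.continuous_map

theorem map_ofUniv (φ : UnivNormed X →⋆ₙₐ[ℂ] UnivNormed Y) (x : UnivNormed X) : map φ (ofUniv X x) = ofUniv Y (φ x) :=
  UniformSpace.Completion.map_coe (uniformContinuous_univ φ) x

theorem map_leftInverse (φ : UnivNormed X →⋆ₙₐ[ℂ] UnivNormed Y) (ψ : UnivNormed Y →⋆ₙₐ[ℂ] UnivNormed X) (h : Function.LeftInverse ψ φ) :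
    Function.LeftInverse (map ψ) (map φ) :=
  eq₁ (f := fun a => map ψ (map φ a)) (g := fun a => a)
    ((continuous_map ψ).comp (continuous_map φ)) continuous_id fun x => by
      rw [map_ofUniv, map_ofUniv, h]

/-- Isomorphic *-algebras have isomorphic enveloping C*-algebras. -/
noncomputable def mapEquiv (φ : UnivNormed X ≃⋆ₐ[ℂ] UnivNormed Y) : CStarEnvelope X ≃⋆ₐ[ℂ] CStarEnvelope Y where
  toFun := map (φ : UnivNormed X →⋆ₙₐ[ℂ] UnivNormed Y)
  invFun := map (φ.symm : UnivNormed Y →⋆ₙₐ[ℂ] UnivNormed X)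
  left_inv := map_leftInverse _ _ φ.symm_apply_apply
  right_inv := map_leftInverse _ _ φ.apply_symm_apply
  map_mul' a b := by
    refine (denseRange_ofUniv X).induction_on₂
      (p := fun a b => map (φ : UnivNormed X →⋆ₙₐ[ℂ] UnivNormed Y) (a * b) = map (φ : UnivNormed X →⋆ₙₐ[ℂ] UnivNormed Y) a * map _ b)
      (isClosed_eq ((continuous_map _).comp (by fun_prop))
        (((continuous_map _).comp continuous_fst).mul ((continuous_map _).comp continuous_snd)))
      (fun x y => ?_) a b
    rw [← ofUniv_mul, map_ofUniv, map_ofUniv, map_ofUniv, ← ofUniv_mul]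
    exact congrArg (ofUniv Y) (map_mul φ x y)
  map_add' a b := by
    refine (denseRange_ofUniv X).induction_on₂
      (p := fun a b => map (φ : UnivNormed X →⋆ₙₐ[ℂ] UnivNormed Y) (a + b) = map (φ : UnivNormed X →⋆ₙₐ[ℂ] UnivNormed Y) a + map _ b)
      (isClosed_eq ((continuous_map _).comp (by fun_prop))
        (((continuous_map _).comp continuous_fst).add ((continuous_map _).comp continuous_snd)))
      (fun x y => ?_) a b
    rw [← ofUniv_add, map_ofUniv, map_ofUniv, map_ofUniv, ← ofUniv_add]
    exact congrArg (ofUniv Y) (map_add φ x y)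
  map_star' a := by
    refine (denseRange_ofUniv X).induction_on
      (p := fun a => map (φ : UnivNormed X →⋆ₙₐ[ℂ] UnivNormed Y) (star a) = star (map (φ : UnivNormed X →⋆ₙₐ[ℂ] UnivNormed Y) a)) a
      (isClosed_eq ((continuous_map _).comp continuous_star) (continuous_map _).star)
      (fun x => ?_)
    rw [← ofUniv_star, map_ofUniv, map_ofUniv, ← ofUniv_star]
    exact congrArg (ofUniv Y) (map_star φ x)
  map_smul' c a := by
    refine (denseRange_ofUniv X).induction_on
      (p := fun a => map (φ : UnivNormed X →⋆ₙₐ[ℂ] UnivNormed Y) (c • a) = c • (map (φ : UnivNormed X →⋆ₙₐ[ℂ] UnivNormed Y) a)) a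
      (isClosed_eq ((continuous_map _).comp (continuous_const_smul c))
        ((continuous_map _).const_smul c))
      (fun x => ?_)
    rw [← ofUniv_smul, map_ofUniv, map_ofUniv, ← ofUniv_smul]
    exact congrArg (ofUniv Y) (map_smul φ c x)

end CStarEnvelope

/-! ### Isometries of `ℓ²(ℕ)` satisfying the Cuntz relations. -/

section Isometries

open ContinuousLinearMap

/-- The standard basis of `ℓ²(ℕ)`. -/
noncomputable def stdBasis : HilbertBasis ℕ ℂ HilbertSeq :=
  HilbertBasis.ofRepr (LinearIsometryEquiv.refl ℂ HilbertSeq)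

/-- An injection of indices turns the basis into an orthonormal family, which spans an isometric
copy of the space. -/
theorem exists_isometry (τ : ℕ → ℕ) (hτ : Function.Injective τ) :
    ∃ v : HilbertSeq →L[ℂ] HilbertSeq, ∀ m, v (stdBasis m) = stdBasis (τ m) := by
  classical
  have ho := (stdBasis.orthonormal.comp τ hτ)
  refine ⟨ho.orthogonalFamily.linearIsometry.toContinuousLinearMap, fun m => ?_⟩
  have : stdBasis m = lp.single 2 m (1 : ℂ) := by
    rw [← HilbertBasis.repr_symm_single]; rfl
  rw [this, LinearIsometry.coe_toContinuousLinearMap,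
    OrthogonalFamily.linearIsometry_apply_single]
  simp

theorem clm_ext_basis {S T : HilbertSeq →L[ℂ] HilbertSeq}
    (h : ∀ m, S (stdBasis m) = T (stdBasis m)) : S = T := by
  refine ContinuousLinearMap.ext_on (s := Set.range stdBasis) ?_ ?_
  · rw [dense_iff_closure_eq]
    have := stdBasis.dense_span
    rw [← Submodule.topologicalClosure_coe, this]; rfl
  · rintro _ ⟨m, rfl⟩; exact h m

/-- A finite nonempty family of isometries with orthogonal ranges summing up to the space. -/
theorem exists_cuntz_family (ι : Type*) [Fintype ι] [Nonempty ι] [DecidableEq ι] :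
    ∃ v : ι → HilbertSeq →L[ℂ] HilbertSeq,
      (∀ i j, star (v i) * v j = if i = j then 1 else 0) ∧ ∑ i, v i * star (v i) = 1 := by
  -- A bijection `ι × ℕ ≃ ℕ` splits the basis into blocks indexed by `ι`; `v i` maps the whole basis
  -- onto the block of `i`.
  have : Denumerable (ι × ℕ) := Classical.choice (nonempty_denumerable _)
  let σ : ι × ℕ ≃ ℕ := Denumerable.eqv _
  choose v hv using fun i => exists_isometry (fun m => σ (i, m)) fun m n h => by
    simpa using h
  have h1 : ∀ i j, star (v i) * v j = if i = j then 1 else 0 := fun i j => by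
    refine clm_ext_basis fun m => stdBasis.repr.injective (lp.ext (funext fun n => ?_))
    rw [stdBasis.repr_apply_apply, stdBasis.repr_apply_apply, mul_apply_eq_comp,
      ContinuousLinearMap.star_eq_adjoint, ContinuousLinearMap.adjoint_inner_right, hv, hv,
      orthonormal_iff_ite.mp stdBasis.orthonormal, apply_ite (fun T : HilbertSeq →L[ℂ] HilbertSeq =>
        inner ℂ (stdBasis n) (T (stdBasis m))), one_apply_eq_self, zero_apply, inner_zero_right,
      orthonormal_iff_ite.mp stdBasis.orthonormal]
    by_cases h : i = j <;> simp [h]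
  refine ⟨v, h1, clm_ext_basis fun n => ?_⟩
  -- Every basis vector is in the range of some `v j`, and `(∑ i, v i * star (v i)) * v j = v j` by
  -- orthogonality of the ranges.
  obtain ⟨⟨j, m⟩, rfl⟩ := σ.surjective n
  rw [← hv, ← mul_apply_eq_comp, Finset.sum_mul]
  simp [mul_assoc, h1]

end Isometries

/-! ### Matrix algebras and stable isomorphism. -/

section Corner

variable {ι : Type u} [Fintype ι] [DecidableEq ι] {A B : Type u} [NonUnitalCStarAlgebra A]
  [NonUnitalCStarAlgebra B]

/-- The matrix over `A` with the single entry `a` at `(i, j)`, transported to an algebra `B` of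
matrices over `A`. -/
noncomputable def matrixUnit (e : B ≃⋆ₐ[ℂ] CStarMatrix ι ι A) (i j : ι) : A →ₗ[ℂ] B where
  toFun a := e.symm (CStarMatrix.ofMatrix (Matrix.single i j a))
  map_add' a b := by rw [← map_add, CStarMatrix.of_add_of, Matrix.single_add]
  map_smul' c a := by rw [RingHom.id_apply, ← map_smul, CStarMatrix.smul_of, Matrix.smul_single]

/-- The entries of an element of an algebra `B` of matrices over `A`. -/
noncomputable def matrixEntry (e : B ≃⋆ₐ[ℂ] CStarMatrix ι ι A) (i j : ι) : B →ₗ[ℂ] A where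
  toFun b := e b i j
  map_add' a b := by rw [map_add, CStarMatrix.add_apply]
  map_smul' c a := by rw [map_smul, CStarMatrix.smul_apply, RingHom.id_apply]

variable (e : B ≃⋆ₐ[ℂ] CStarMatrix ι ι A)

omit [DecidableEq ι] in
theorem matrixEntry_apply (i j : ι) (b : B) : matrixEntry e i j b = e b i j := rfl

theorem apply_matrixUnit (i j p q : ι) (a : A) :
    e (matrixUnit e i j a) p q = if i = p ∧ j = q then a else 0 := by
  change e (e.symm _) p q = _
  rw [StarAlgEquiv.apply_symm_apply]
  exact Matrix.single_apply i j a p q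

theorem sum_matrixUnit (b : B) : ∑ i, ∑ j, matrixUnit e i j (e b i j) = b := by
  apply EquivLike.injective e
  ext p q
  have : ∀ M : ι → ι → B, e (∑ i, ∑ j, M i j) p q = ∑ i, ∑ j, e (M i j) p q := fun M => by
    simp only [← matrixEntry_apply, map_sum]
  rw [this, Finset.sum_eq_single p, Finset.sum_eq_single q] <;>
    simp +contextual [apply_matrixUnit]

theorem matrixUnit_mul (i j : ι) (a : A) (b : B) :
    matrixUnit e i j a * b = ∑ q, matrixUnit e i q (a * e b j q) := by
  apply EquivLike.injective e
  ext p r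
  have : ∀ M : ι → B, e (∑ i, M i) p r = ∑ i, e (M i) p r := fun M => by
    simp only [← matrixEntry_apply, map_sum]
  rw [this, map_mul, CStarMatrix.mul_apply, Finset.sum_eq_single j, Finset.sum_eq_single r]
  · simp only [apply_matrixUnit]
    by_cases h : i = p <;> simp [h]
  all_goals simp +contextual [apply_matrixUnit, eq_comm]

theorem matrixUnit_mul_matrixUnit (i j k l : ι) (a b : A) :
    matrixUnit e i j a * matrixUnit e k l b = if j = k then matrixUnit e i l (a * b) else 0 := by
  rw [matrixUnit_mul, Finset.sum_eq_single l]
  · rw [apply_matrixUnit]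
    by_cases h : j = k <;> simp [h, eq_comm]
  all_goals simp +contextual [apply_matrixUnit, eq_comm]

theorem star_matrixUnit (i j : ι) (a : A) :
    star (matrixUnit e i j a) = matrixUnit e j i (star a) := by
  apply EquivLike.injective e
  ext p q
  rw [map_star, CStarMatrix.star_apply, apply_matrixUnit, apply_matrixUnit]
  by_cases h : i = q <;> by_cases h' : j = p <;> simp [h, h']

theorem matrixUnit_mul_mul (i j k l : ι) (a c : A) (b : B) :
    matrixUnit e i j a * b * matrixUnit e k l c = matrixUnit e i l (a * e b j k * c) := by
  rw [matrixUnit_mul, Finset.sum_mul, Finset.sum_eq_single k]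
  · simp [matrixUnit_mul_matrixUnit]
  all_goals simp +contextual [matrixUnit_mul_matrixUnit]

section Absorb

variable {K : Type w} [NonUnitalCStarAlgebra K] (c d : ι → ι → K →ₗ[ℂ] K)

/-- The map `k ⊗ b ↦ ∑ i j, c i j k ⊗ b i j` from `K ⊗ M_n(A)` to `K ⊗ A`. -/
noncomputable def absorbMatrix : K ⊗[ℂ] B →ₗ[ℂ] K ⊗[ℂ] A :=
  ∑ i, ∑ j, TensorProduct.map (c i j) (matrixEntry e i j)

/-- The map `k ⊗ a ↦ ∑ i j, d i j k ⊗ e i j (a)` from `K ⊗ A` to `K ⊗ M_n(A)`. -/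
noncomputable def releaseMatrix : K ⊗[ℂ] A →ₗ[ℂ] K ⊗[ℂ] B :=
  ∑ i, ∑ j, TensorProduct.map (d i j) (matrixUnit e i j)

omit [DecidableEq ι] in
theorem absorbMatrix_tmul (k : K) (b : B) : absorbMatrix e c (k ⊗ₜ b) =
    ∑ i, ∑ j, c i j k ⊗ₜ e b i j := by
  simp [absorbMatrix, LinearMap.sum_apply, matrixEntry_apply]

theorem releaseMatrix_tmul (k : K) (a : A) : releaseMatrix e d (k ⊗ₜ a) =
    ∑ i, ∑ j, d i j k ⊗ₜ matrixUnit e i j a := by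
  simp [releaseMatrix, LinearMap.sum_apply]

variable {c d}

/-- In the application `c i j k = v i * k * star (v j)` and `d i j k = star (v i) * k * v j`. The
hypothesis here then expresses that the isometries have orthogonal ranges. -/
theorem release_absorb (h : ∀ p q i j k, d p q (c i j k) = if p = i ∧ q = j then k else 0)
    (x : K ⊗[ℂ] B) : releaseMatrix e d (absorbMatrix e c x) = x := by
  induction x with
  | zero => simp
  | add x y hx hy => rw [map_add, map_add, hx, hy]
  | tmul k b =>
    conv_rhs => rw [← sum_matrixUnit e b]
    simp only [absorbMatrix_tmul, map_sum, releaseMatrix_tmul, h, TensorProduct.tmul_sum]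
    refine Finset.sum_congr rfl fun i _ => Finset.sum_congr rfl fun j _ => ?_
    rw [Finset.sum_eq_single i, Finset.sum_eq_single j] <;> simp +contextual

/-- The other half of bijectivity; for the isometries `v` the hypothesis comes from `∑ i, v i * star
(v i) = 1`. -/
theorem absorb_release (h : ∀ k, ∑ i, ∑ j, c i j (d i j k) = k)
    (x : K ⊗[ℂ] A) : absorbMatrix e c (releaseMatrix e d x) = x := by
  induction x with
  | zero => simp
  | add x y hx hy => rw [map_add, map_add, hx, hy]
  | tmul k a =>
    conv_rhs => rw [← h k]
    simp only [absorbMatrix_tmul, map_sum, releaseMatrix_tmul, TensorProduct.sum_tmul]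
    refine Finset.sum_congr rfl fun i _ => Finset.sum_congr rfl fun j _ => ?_
    rw [Finset.sum_eq_single i, Finset.sum_eq_single j] <;>
      simp +contextual [apply_matrixUnit, eq_comm]

/-- The maps `c i j` multiply like matrix units, which collapses the two inner indices and leaves
the matrix product of the entries. -/
theorem absorb_mul (h : ∀ i p q j k l, c i p k * c q j l = if p = q then c i j (k * l) else 0)
    (x y : K ⊗[ℂ] B) :
    absorbMatrix e c (x * y) = absorbMatrix e c x * absorbMatrix e c y := by
  induction x with
  | zero => simp
  | add x y hx hy => simp only [add_mul, map_add, hx, hy]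
  | tmul k b =>
    induction y with
    | zero => simp
    | add x y hx hy => simp only [mul_add, map_add, hx, hy]
    | tmul l b' =>
      have hR : ∀ i p, c i p k ⊗ₜ[ℂ] e b i p * ∑ q, ∑ j, c q j l ⊗ₜ[ℂ] e b' q j =
          ∑ j, c i j (k * l) ⊗ₜ[ℂ] (e b i p * e b' p j) := fun i p => by
        rw [Finset.mul_sum, Finset.sum_eq_single p]
        · simp [Finset.mul_sum, Algebra.TensorProduct.tmul_mul_tmul, h]
        · intro q _ hq
          simp [Finset.mul_sum, Algebra.TensorProduct.tmul_mul_tmul, h, hq.symm]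
        · simp
      rw [Algebra.TensorProduct.tmul_mul_tmul]
      simp only [absorbMatrix_tmul, Finset.sum_mul, hR, map_mul, CStarMatrix.mul_apply,
        TensorProduct.tmul_sum]
      exact Finset.sum_congr rfl fun i _ => Finset.sum_comm

omit [DecidableEq ι] in
theorem absorb_star (h : ∀ i j k, star (c i j k) = c j i (star k)) (x : K ⊗[ℂ] B) :
    absorbMatrix e c (star x) = star (absorbMatrix e c x) := by
  induction x with
  | zero => simp
  | add x y hx hy => simp only [star_add, map_add, hx, hy]
  | tmul k b =>
    simp only [TensorProduct.star_tmul, absorbMatrix_tmul, star_sum, h, map_star,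
      CStarMatrix.star_apply]
    rw [Finset.sum_comm]

end Absorb

/-- The map `k ↦ S * k * T` on the compact operators. -/
noncomputable def compressCompact (S T : HilbertSeq →L[ℂ] HilbertSeq) : KAlg →ₗ[ℂ] KAlg where
  toFun k := ⟨S * k * T, IsCompactOperator.comp_clm (IsCompactOperator.clm_comp k.2 S) T⟩
  map_add' k l := Subtype.ext (by simp [mul_add, add_mul])
  map_smul' c k := Subtype.ext (by simp)

theorem coe_compressCompact (S T : HilbertSeq →L[ℂ] HilbertSeq) (k : KAlg) :
    (compressCompact S T k : HilbertSeq →L[ℂ] HilbertSeq) = S * k * T := rfl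

/-- A matrix algebra over `A` is stably isomorphic to `A`. -/
theorem nonempty_stabilization_equiv [Nonempty ι] (e : B ≃⋆ₐ[ℂ] CStarMatrix ι ι A) :
    Nonempty (Stabilization B ≃⋆ₐ[ℂ] Stabilization A) := by
  -- The row `(v i)` is a unitary from `n` copies of the Hilbert space onto one. Conjugation by it
  -- is `k ⊗ b ↦ ∑ v i * k * star (v j) ⊗ b i j`, with inverse built from `star (v i) * k * v j`.
  obtain ⟨v, hv, hv1⟩ := exists_cuntz_family ι
  have hleft : ∀ p q i j k, compressCompact (star (v p)) (v q)
      (compressCompact (v i) (star (v j)) k) = if p = i ∧ q = j then k else 0 :=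
    fun p q i j k => by
      apply Subtype.ext
      rw [coe_compressCompact, coe_compressCompact, mul_assoc _ _ (v q), mul_assoc _ _ (v q),
        hv, ← mul_assoc, ← mul_assoc, hv]
      by_cases h : p = i <;> by_cases h' : q = j <;> simp [h, h', Ne.symm]
  have hright : ∀ k, ∑ i, ∑ j, compressCompact (v i) (star (v j))
      (compressCompact (star (v i)) (v j) k) = k := fun k => by
    apply Subtype.ext
    have : ((∑ i, ∑ j, compressCompact (v i) (star (v j))
        (compressCompact (star (v i)) (v j) k) : KAlg) : HilbertSeq →L[ℂ] HilbertSeq) =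
        (∑ i, v i * star (v i)) * k * ∑ j, v j * star (v j) := by
      simp only [AddSubmonoidClass.coe_finsetSum, coe_compressCompact, Finset.sum_mul,
        Finset.mul_sum, mul_assoc]
      rw [Finset.sum_comm]
    rw [this, hv1, one_mul, mul_one]
  have hmul : ∀ i p q j k l, compressCompact (v i) (star (v p)) k *
      compressCompact (v q) (star (v j)) l =
      if p = q then compressCompact (v i) (star (v j)) (k * l) else 0 := fun i p q j k l => by
    apply Subtype.ext
    rw [MulMemClass.coe_mul, coe_compressCompact, coe_compressCompact,
      show v i * (k : HilbertSeq →L[ℂ] HilbertSeq) * star (v p) * (v q * l * star (v j)) =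
        v i * k * (star (v p) * v q) * (l * star (v j)) by simp only [mul_assoc], hv]
    by_cases h : p = q <;> simp [h, coe_compressCompact, mul_assoc]
  have hstar : ∀ i j k, star (compressCompact (v i) (star (v j)) k) =
      compressCompact (v j) (star (v i)) (star k) := fun i j k => by
    apply Subtype.ext
    rw [StarMemClass.coe_star, coe_compressCompact, coe_compressCompact, star_mul, star_mul,
      star_star, mul_assoc]
    rfl
  exact ⟨CStarEnvelope.mapEquiv
    { toFun := absorbMatrix e fun i j => compressCompact (v i) (star (v j))
      invFun := releaseMatrix e fun i j => compressCompact (star (v i)) (v j)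
      left_inv := release_absorb e hleft
      right_inv := absorb_release e hright
      map_mul' := absorb_mul e hmul
      map_add' := map_add _
      map_star' := absorb_star e hstar
      map_smul' := map_smul _ }⟩

theorem IsStableProperty.of_matrix {P : CStarProperty.{u}} (hstable : IsStableProperty P)
    [Nonempty ι] (e : B ≃⋆ₐ[ℂ] CStarMatrix ι ι A) (hB : P B) : P A :=
  hstable B A hB ((nonempty_stabilization_equiv e).map StarAlgEquiv.symm)

/-- `A` is an algebra of one by one matrices over `B`. -/
theorem IsStableProperty.of_equiv {P : CStarProperty.{u}} (hstable : IsStableProperty P)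
    (f : A ≃⋆ₐ[ℂ] B) (hA : P A) : P B :=
  hstable.of_matrix (ι := PUnit.{u + 1}) (f.trans (CStarMatrix.toOneByOne PUnit ℂ B)) hA

end Corner

/-! ### Ideals of matrix algebras and largest ideals. -/

section Ideals

variable {A : Type u} [NonUnitalCStarAlgebra A]

/-- Replaces multiplication by a unit: `a` is the limit of the products `a * f n (star a * a)`. -/
theorem mem_of_forall_mul_mem {S : Set A} (hS : IsClosed S) {a : A} (h : ∀ w, a * w ∈ S) :
    a ∈ S := by
  choose f hf using exists_cfc_approx_unit (star a)
  have hlim : Filter.Tendsto (fun n => a * cfcₙ (f n) (star a * a)) Filter.atTop (nhds a) := by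
    rw [tendsto_iff_norm_sub_tendsto_zero]
    have h1 : Filter.Tendsto (fun n => ‖a * cfcₙ (f n) (star a * a) - a‖ ^ 2)
        Filter.atTop (nhds 0) :=
      squeeze_zero (fun n => by positivity)
        (fun n => by rw [norm_sub_rev]; simpa using hf n) tendsto_one_div_add_atTop_nhds_zero_nat
    simpa using h1.sqrt
  exact hS.mem_of_tendsto hlim (Filter.Eventually.of_forall fun n => h _)

/-- The one-sided case removes `w`; applied to `star a` and the preimage of `S` under the
involution, it also removes `u`. -/
theorem mem_of_forall_mul_mul_mem {S : Set A} (hS : IsClosed S) {a : A}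
    (h : ∀ u w, u * a * w ∈ S) : a ∈ S := by
  have h1 : ∀ u, u * a ∈ S := fun u => mem_of_forall_mul_mem hS (h u)
  have h2 : star a ∈ star ⁻¹' S :=
    mem_of_forall_mul_mem (hS.preimage continuous_star) fun w => by simpa using h1 (star w)
  simpa using h2

variable {ι : Type u} [Fintype ι] [DecidableEq ι] {B : Type u} [NonUnitalCStarAlgebra B]
  (e : B ≃⋆ₐ[ℂ] CStarMatrix ι ι A)

/-- On the diagonal, `matrixUnit e j j` is a *-homomorphism, hence contractive. The C*-identity
reduces the entry `(i, j)` to this case, since `x = matrixUnit e i j a` has `star x * x = matrixUnit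
e j j (star a * a)`. -/
theorem norm_matrixUnit_le (i j : ι) (a : A) : ‖matrixUnit e i j a‖ ≤ ‖a‖ := by
  let φ : A →⋆ₙₐ[ℂ] B :=
    { matrixUnit e j j with
      map_zero' := map_zero (matrixUnit e j j)
      map_mul' := fun a b => by simpa using (matrixUnit_mul_matrixUnit e j j j j a b).symm
      map_star' := fun a => (star_matrixUnit e j j a).symm }
  have h := NonUnitalStarAlgHom.norm_apply_le φ (star a * a)
  have h2 : φ (star a * a) = star (matrixUnit e i j a) * matrixUnit e i j a := by
    rw [star_matrixUnit, matrixUnit_mul_matrixUnit, if_pos rfl]; rfl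
  rw [h2, CStarRing.norm_star_mul_self, CStarRing.norm_star_mul_self] at h
  exact abs_le_of_sq_le_sq' (by nlinarith) (norm_nonneg _) |>.2

theorem continuous_matrixUnit (i j : ι) : Continuous (matrixUnit e i j) :=
  (AddMonoidHomClass.lipschitz_of_bound (matrixUnit e i j) 1 fun a => by
    rw [one_mul]; exact norm_matrixUnit_le e i j a).continuous

/-- The ideal of `A` formed by the entries of the elements of an ideal of matrices over `A`. -/
noncomputable def entryIdeal [Nonempty ι] (J : ClosedIdeal B) : ClosedIdeal A where
  carrier := {a | ∀ i j, matrixUnit e i j a ∈ J}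
  add_mem' ha hb i j := by rw [map_add]; exact add_mem (ha i j) (hb i j)
  zero_mem' i j := by rw [map_zero]; exact zero_mem J
  smul_mem' c a ha i j := by rw [map_smul]; exact SMulMemClass.smul_mem c (ha i j)
  mul_mem_left' a b hb i j := by
    have := J.mul_mem_left' (matrixUnit e i i a) (hb i j)
    rwa [matrixUnit_mul_matrixUnit, if_pos rfl] at this
  mul_mem_right' a b hb i j := by
    have := J.mul_mem_right' (matrixUnit e j j a) (hb i j)
    rwa [matrixUnit_mul_matrixUnit, if_pos rfl] at this
  isClosed' := by
    have : {a | ∀ i j, matrixUnit e i j a ∈ J} =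
        ⋂ i, ⋂ j, matrixUnit e i j ⁻¹' (J : Set B) := by ext; simp
    rw [this]
    exact isClosed_iInter fun i => isClosed_iInter fun j =>
      J.isClosed'.preimage (continuous_matrixUnit e i j)

variable [Nonempty ι]

/-- Multiplying `b` by matrix units with entries `u` and `w` isolates `u * e b i j * w` at any
position `(p, q)`. As `A` may have no unit, `u` and `w` are removed by approximation. -/
theorem entry_mem_entryIdeal {J : ClosedIdeal B} {b : B} (hb : b ∈ J) (i j : ι) :
    e b i j ∈ entryIdeal e J := fun p q =>
  mem_of_forall_mul_mul_mem (J.isClosed'.preimage (continuous_matrixUnit e p q)) fun u w => by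
    have := J.mul_mem_right' (matrixUnit e j q w) (J.mul_mem_left' (matrixUnit e p i u) hb)
    rwa [matrixUnit_mul_mul] at this

theorem mem_of_entry_mem_entryIdeal {J : ClosedIdeal B} {b : B}
    (hb : ∀ i j, e b i j ∈ entryIdeal e J) : b ∈ J := by
  rw [← sum_matrixUnit e b]
  exact sum_mem fun i _ => sum_mem fun j _ => hb i j i j

/-- An ideal of matrices over `A` is the algebra of matrices over its ideal of entries. -/
noncomputable def idealEquivMatrix (J : ClosedIdeal B) :
    J ≃⋆ₐ[ℂ] CStarMatrix ι ι (entryIdeal e J) where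
  toFun b := CStarMatrix.ofMatrix fun i j => ⟨e b i j, entry_mem_entryIdeal e b.2 i j⟩
  invFun M := ⟨e.symm (CStarMatrix.ofMatrix fun i j => (M i j : A)),
    mem_of_entry_mem_entryIdeal e fun i j => by
      rw [StarAlgEquiv.apply_symm_apply]; exact (M i j).2⟩
  left_inv b := Subtype.ext (e.symm_apply_apply b)
  right_inv M := by
    ext i j
    exact congrFun (congrFun (e.apply_symm_apply (CStarMatrix.ofMatrix fun i j => (M i j : A))) i) j
  map_mul' b c := by
    ext i j
    rw [CStarMatrix.mul_apply, AddSubmonoidClass.coe_finsetSum]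
    change e (b * c) i j = _
    rw [map_mul, CStarMatrix.mul_apply]
    rfl
  map_add' b c := by
    ext i j
    exact congrFun (congrFun (map_add e (b : B) c) i) j
  map_star' b := by
    ext i j
    exact congrFun (congrFun (map_star e (b : B)) i) j
  map_smul' c b := by
    ext i j
    exact congrFun (congrFun (map_smul e c (b : B)) i) j

theorem prop_largestIdeal {P : CStarProperty.{u}} (hP : AdmitsLargestIdeals P)
    (A : Type u) [NonUnitalCStarAlgebra A] : P (largestIdeal hP A) := (hP A).choose_spec.1

theorem le_largestIdeal {P : CStarProperty.{u}} (hP : AdmitsLargestIdeals P)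
    {A : Type u} [NonUnitalCStarAlgebra A] {J : ClosedIdeal A} (hJ : P J) :
    J ≤ largestIdeal hP A := (hP A).choose_spec.2 J hJ

/-- The largest ideal of a matrix algebra over `A` has entries in the largest ideal of `A`. -/
theorem entry_mem_largestIdeal {P : CStarProperty.{u}} (hstable : IsStableProperty P)
    (hP : AdmitsLargestIdeals P) {b : B} (hb : b ∈ largestIdeal hP B) (i j : ι) :
    e b i j ∈ largestIdeal hP A :=
  le_largestIdeal hP
    (hstable.of_matrix (idealEquivMatrix e (largestIdeal hP B)) (prop_largestIdeal hP B))
    (entry_mem_entryIdeal e hb i j)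

/-- The preimage of an ideal under an automorphism. -/
noncomputable def ClosedIdeal.comap (f : A ≃⋆ₐ[ℂ] A) (I : ClosedIdeal A) : ClosedIdeal A where
  carrier := {a | f a ∈ I}
  add_mem' ha hb := by
    change f _ ∈ I; rw [map_add]; exact add_mem ha hb
  zero_mem' := by change f 0 ∈ I; rw [map_zero]; exact zero_mem I
  smul_mem' c a ha := by change f _ ∈ I; rw [map_smul]; exact SMulMemClass.smul_mem c ha
  mul_mem_left' a b hb := by
    change f _ ∈ I; rw [map_mul]; exact I.mul_mem_left' _ hb
  mul_mem_right' a b hb := by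
    change f _ ∈ I; rw [map_mul]; exact I.mul_mem_right' _ hb
  isClosed' := I.isClosed'.preimage (NonUnitalStarAlgHom.isometry f f.injective).continuous

/-- An automorphism restricted to the preimage of an ideal. -/
noncomputable def ClosedIdeal.comapEquiv (f : A ≃⋆ₐ[ℂ] A) (I : ClosedIdeal A) :
    I.comap f ≃⋆ₐ[ℂ] I where
  toFun a := ⟨f a, a.2⟩
  invFun a := ⟨f.symm a, by change f (f.symm a) ∈ I; rw [StarAlgEquiv.apply_symm_apply]; exact a.2⟩
  left_inv a := Subtype.ext (f.symm_apply_apply a)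
  right_inv a := Subtype.ext (f.apply_symm_apply a)
  map_mul' a b := Subtype.ext (map_mul f (a : A) b)
  map_add' a b := Subtype.ext (map_add f (a : A) b)
  map_star' a := Subtype.ext (map_star f (a : A))
  map_smul' c a := Subtype.ext (map_smul f c (a : A))

/-- The image of the largest ideal under `f` is an ideal isomorphic to it, so it has `P` and lies in
the largest ideal. -/
theorem apply_mem_largestIdeal {P : CStarProperty.{u}} (hstable : IsStableProperty P)
    (hP : AdmitsLargestIdeals P) (f : A ≃⋆ₐ[ℂ] A) {a : A} (ha : a ∈ largestIdeal hP A) :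
    f a ∈ largestIdeal hP A := by
  have h : P ((largestIdeal hP A).comap f.symm) :=
    hstable.of_equiv ((largestIdeal hP A).comapEquiv f.symm).symm (prop_largestIdeal hP A)
  refine le_largestIdeal hP h ?_
  change f.symm (f a) ∈ largestIdeal hP A
  rwa [StarAlgEquiv.symm_apply_apply]

/-- An ideal that contains every element is isomorphic to the algebra. -/
noncomputable def ClosedIdeal.topEquiv (I : ClosedIdeal A) (hI : ∀ a, a ∈ I) : I ≃⋆ₐ[ℂ] A where
  toFun a := a
  invFun a := ⟨a, hI a⟩
  map_mul' _ _ := rfl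
  map_add' _ _ := rfl
  map_star' _ := rfl
  map_smul' _ _ := rfl

/-- The whole algebra as an ideal. -/
noncomputable def ClosedIdeal.whole (A : Type u) [NonUnitalCStarAlgebra A] : ClosedIdeal A where
  toSubmodule := ⊤
  mul_mem_left' _ _ _ := trivial
  mul_mem_right' _ _ _ := trivial
  isClosed' := isClosed_univ

theorem prop_iff_forall_mem_largestIdeal {P : CStarProperty.{u}} (hstable : IsStableProperty P)
    (hP : AdmitsLargestIdeals P) : P A ↔ ∀ a : A, a ∈ largestIdeal hP A := by
  refine ⟨fun h a => ?_, fun h => hstable.of_equiv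
    ((largestIdeal hP A).topEquiv h) (prop_largestIdeal hP A)⟩
  exact le_largestIdeal hP (J := ClosedIdeal.whole A)
    (hstable.of_equiv ((ClosedIdeal.whole A).topEquiv fun _ => trivial).symm h) trivial

end Ideals

/-! ### Self-duality of finite abelian groups and orthogonality of characters. -/

section Characters

variable (G : Type u) [CommGroup G] [Fintype G]

/-- A finite abelian group has a perfect pairing with itself. -/
theorem exists_pairing [DecidableEq G] : ∃ χ : G →* G →* ℂˣ,
    (∀ g s, star (χ g s : ℂ) = χ g⁻¹ s) ∧
    (∀ s, ∑ g, (χ g s : ℂ) = if s = 1 then (Fintype.card G : ℂ) else 0) ∧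
    (∀ g, ∑ s, (χ g s : ℂ) = if g = 1 then (Fintype.card G : ℂ) else 0) := by
  obtain ⟨e⟩ := CommGroup.monoidHom_mulEquiv_of_hasEnoughRootsOfUnity G ℂ
  have hsum : ∀ φ : G →* ℂˣ, ∑ g, (φ g : ℂ) = if φ = 1 then (Fintype.card G : ℂ) else 0 := by
    intro φ
    split_ifs with h
    · simp [h]
    · obtain ⟨a, ha⟩ : ∃ a, φ a ≠ 1 := by
        by_contra! hc
        exact h (MonoidHom.ext hc)
      -- Translation by `a` permutes the summands, so the sum is fixed by a factor `φ a ≠ 1`.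
      have h1 : (φ a : ℂ) * ∑ g, (φ g : ℂ) = ∑ g, (φ g : ℂ) := by
        rw [Finset.mul_sum]
        exact Fintype.sum_equiv (Equiv.mulLeft a) _ _ fun g => by simp
      have h2 : ((φ a : ℂ) - 1) * ∑ g, (φ g : ℂ) = 0 := by rw [sub_mul, h1, one_mul, sub_self]
      refine (mul_eq_zero.mp h2).resolve_left fun h0 => ha ?_
      exact Units.ext (sub_eq_zero.mp h0)
  refine ⟨e.symm.toMonoidHom, fun g s => ?_, fun s => ?_, fun g => ?_⟩
  -- The values are roots of unity, hence of modulus one, and conjugation is inversion.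
  · have hpow : ((e.symm g s : ℂˣ) : ℂ) ^ Fintype.card G = 1 := by
      rw [← Units.val_pow_eq_pow_val, ← map_pow, pow_card_eq_one]; simp
    have hn := Complex.norm_eq_one_of_pow_eq_one hpow Fintype.card_ne_zero
    change star ((e.symm g s : ℂˣ) : ℂ) = (e.symm g⁻¹ s : ℂˣ)
    rw [map_inv, MonoidHom.inv_apply, Units.val_inv_eq_inv_val, Complex.inv_def,
      Complex.normSq_eq_norm_sq, hn]
    simp
  -- For fixed `s` the pairing is a character in `g`, trivial only for `s = 1` because characters
  -- separate points.
  · have := hsum ((MonoidHom.eval s).comp e.symm.toMonoidHom)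
    rw [show ∑ g, ((e.symm.toMonoidHom g s : ℂˣ) : ℂ) =
      ∑ g, ((((MonoidHom.eval s).comp e.symm.toMonoidHom) g : ℂˣ) : ℂ) from rfl, this]
    refine if_congr ⟨fun h => ?_, fun h => ?_⟩ rfl rfl
    · by_contra hs
      obtain ⟨φ, hφ⟩ := CommGroup.exists_apply_ne_one_of_hasEnoughRootsOfUnity G ℂ hs
      have := DFunLike.congr_fun h (e φ)
      apply hφ
      simpa using this
    · subst h; ext g; simp
  · rw [hsum]
    refine if_congr ?_ rfl rfl
    exact map_eq_one_iff e.symm e.symm.injective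

end Characters

/-! ### Ideals of crossed products. -/

namespace CrossedProduct

variable {G : Type u} [CommGroup G] [Fintype G] {A : Type u} [NonUnitalCStarAlgebra A]
  (α : G →* (A ≃⋆ₐ[ℂ] A)) (χ : G →* G →* ℂˣ)

/-- The regular representation is isometric and matrices carry the topology of entrywise
convergence, so the topology of the crossed product is that of its coefficients. -/
theorem continuous_of_coeff {X : Type*} [TopologicalSpace X] {f : X → CrossedProduct α}
    (hf : ∀ s, Continuous fun x => f x s) : Continuous f := by
  let _ : PartialOrder A := CStarAlgebra.spectralOrder A
  have _ : StarOrderedRing A := CStarAlgebra.spectralOrderedRing A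
  have hiso : Isometry (regularRep α) :=
    NonUnitalStarAlgHom.isometry (regularRep α) (toMatrix_injective α)
  rw [hiso.isUniformInducing.isInducing.continuous_iff]
  exact continuous_pi (A := fun _ : G => G → A) fun s => continuous_pi fun t =>
    (NonUnitalStarAlgHom.isometry (α s⁻¹) (α s⁻¹).injective).continuous.comp (hf (s * t⁻¹))

theorem continuous_coeff (s : G) : Continuous fun f : CrossedProduct α => f s := by
  let _ : PartialOrder A := CStarAlgebra.spectralOrder A
  have _ : StarOrderedRing A := CStarAlgebra.spectralOrderedRing A
  have h : Continuous fun f : CrossedProduct α => regularRep α f 1 s⁻¹ :=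
    (continuous_apply s⁻¹).comp ((continuous_apply (A := fun _ : G => G → A) 1).comp
      (NonUnitalStarAlgHom.isometry (regularRep α) (toMatrix_injective α)).continuous)
  have h2 : ∀ f : CrossedProduct α, regularRep α f 1 s⁻¹ = f s := fun f => by
    change α 1⁻¹ (f (1 * s⁻¹⁻¹)) = f s
    simp
  simpa only [h2] using h

/-- The ideal `C*(G, I, α)` of the crossed product. -/
noncomputable def closedIdeal (I : ClosedIdeal A) (hI : ∀ g, ∀ a ∈ I, α g a ∈ I) :
    ClosedIdeal (CrossedProduct α) where
  carrier := ofIdeal α I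
  add_mem' hf hg s := add_mem (hf s) (hg s)
  zero_mem' s := zero_mem I
  smul_mem' c f hf s := SMulMemClass.smul_mem c (hf s)
  mul_mem_left' f g hg s := by
    rw [mul_apply]
    exact sum_mem fun r _ => I.mul_mem_left' _ (hI r _ (hg _))
  mul_mem_right' f g hg s := by
    rw [mul_apply]
    exact sum_mem fun r _ => I.mul_mem_right' _ (hg _)
  isClosed' := by
    have : ofIdeal α I = ⋂ s, (fun f : CrossedProduct α => f s) ⁻¹' (I : Set A) := by
      ext; simp [ofIdeal]
    rw [this]
    exact isClosed_iInter fun s => I.isClosed'.preimage (continuous_coeff α s)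

/-- The ideal `C*(G, I, α)` is the crossed product by the restricted action. -/
noncomputable def closedIdealEquiv (I : ClosedIdeal A) (hI : ∀ g, ∀ a ∈ I, α g a ∈ I) :
    CrossedProduct (restrictAction α I hI) ≃⋆ₐ[ℂ] closedIdeal α I hI where
  toFun f := ⟨ofIdealHom α I hI f, fun s => (f s).2⟩
  invFun f := ofFun _ fun s => ⟨(f : CrossedProduct α) s, f.2 s⟩
  left_inv _ := rfl
  right_inv _ := rfl
  map_mul' f g := Subtype.ext (map_mul (ofIdealHom α I hI) f g)
  map_add' f g := Subtype.ext (map_add (ofIdealHom α I hI) f g)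
  map_star' f := Subtype.ext (map_star (ofIdealHom α I hI) f)
  map_smul' c f := Subtype.ext (map_smul (ofIdealHom α I hI) c f)

open Classical in
/-- If the canonical image of an ideal `I` of `A` lies in an ideal `J` of the crossed product,
then so do all functions with values in `I`. -/
theorem mem_of_incl_mem {I : ClosedIdeal A} {J : ClosedIdeal (CrossedProduct α)}
    (h : ∀ a ∈ I, incl α a ∈ J) {f : CrossedProduct α} (hf : ∀ s, f s ∈ I) : f ∈ J := by
  -- `S s a` stands for `a u_s`. If `A` has no unit, `u_s` itself is not in the crossed product, so
  -- `a u_s` is reached as a limit of the products `a * (w u_s)`, which lie in `J`.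
  let S : G → A → CrossedProduct α := fun s a => ofFun α (Pi.single s a)
  have hS : ∀ s, Continuous (S s) := fun s => continuous_of_coeff α fun t => by
    change Continuous fun a : A => (Pi.single s a : G → A) t
    by_cases ht : t = s
    · subst ht; simpa using continuous_id'
    · simpa [ht] using continuous_const
  have hmul : ∀ s a w, S s (a * w) = incl α a * S s w := fun s a w => by
    ext t
    rw [mul_apply, Fintype.sum_eq_single 1 fun r hr => by simp [incl_apply, hr]]
    by_cases ht : t = s
    · subst ht; simp [S, incl_apply]
    · simp [S, incl_apply, ht]
  have hsum : f = ∑ s, S s (f s) := (Finset.univ_sum_single (f : G → A)).symm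
  rw [hsum]
  refine sum_mem fun s _ => mem_of_forall_mul_mem (J.isClosed'.preimage (hS s)) fun w => ?_
  change S s (f s * w) ∈ J
  rw [hmul]
  exact J.mul_mem_right' _ (h _ (hf s))

/-! ### The dual action and Takai duality. -/

section Dual

variable {χ}

/-- The dual action, transported to `G` along a pairing of `G` with itself. -/
noncomputable def dualAction (hχ : ∀ g s, star (χ g s : ℂ) = χ g⁻¹ s) :
    G →* (CrossedProduct α ≃⋆ₐ[ℂ] CrossedProduct α) where
  toFun g :=
    { toFun := fun f => ofFun α fun s => (χ g s : ℂ) • f s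
      invFun := fun f => ofFun α fun s => (χ g⁻¹ s : ℂ) • f s
      left_inv := fun f => by ext s; simp [smul_smul]
      right_inv := fun f => by ext s; simp [smul_smul]
      map_mul' := fun f h => by
        ext s
        simp only [ofFun_apply, mul_apply, Finset.smul_sum, map_smul, smul_mul_smul_comm]
        refine Finset.sum_congr rfl fun r _ => ?_
        rw [← Units.val_mul, ← map_mul, mul_inv_cancel_left]
      map_add' := fun f h => by ext s; simp
      map_star' := fun f => by
        ext s
        simp only [ofFun_apply, star_apply, star_smul, map_smul, hχ]
        simp
      map_smul' := fun c f => by ext s; simp [smul_comm c] }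
  map_one' := by ext f s; change ((χ 1 s : ℂˣ) : ℂ) • f s = f s; simp
  map_mul' g h := by
    ext f s
    change ((χ (g * h) s : ℂˣ) : ℂ) • f s = (χ g s : ℂ) • (χ h s : ℂ) • f s
    simp [smul_smul]

variable (hχ : ∀ g s, star (χ g s : ℂ) = χ g⁻¹ s)

theorem dualAction_apply (g : G) (f : CrossedProduct α) (s : G) :
    dualAction α hχ g f s = (χ g s : ℂ) • f s := rfl

/-- The isomorphism of Takai duality as a map. -/
noncomputable def takaiFun (F : CrossedProduct (dualAction α hχ)) : CStarMatrix G G A :=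
  CStarMatrix.ofMatrix fun s t => ∑ g, (χ g t : ℂ) • toMatrix α (F g) s t

theorem takaiFun_apply (F : CrossedProduct (dualAction α hχ)) (s t : G) :
    takaiFun α hχ F s t = ∑ g, (χ g t : ℂ) • toMatrix α (F g) s t := rfl

/-- This is covariance: with `D_g` the diagonal unitary with entries `χ g t`, the dual action
becomes conjugation by `D_g` in the regular representation. Accordingly `takaiFun` is `F ↦ ∑ g,
toMatrix α (F g) * D_g`. -/
theorem toMatrix_dualAction (g : G) (f : CrossedProduct α) (s t : G) :
    toMatrix α (dualAction α hχ g f) s t = (χ g (s * t⁻¹) : ℂ) • toMatrix α f s t := by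
  rw [toMatrix_apply, dualAction_apply, map_smul, toMatrix_apply]

theorem toMatrix_sum {ι : Type*} (S : Finset ι) (F : ι → CrossedProduct α) :
    toMatrix α (∑ i ∈ S, F i) = ∑ i ∈ S, toMatrix α (F i) := map_sum (regularRep α) F S

omit [CommGroup G] [Fintype G] in
theorem matrix_sum_apply {ι : Type*} (S : Finset ι) (M : ι → CStarMatrix G G A) (s t : G) :
    (∑ i ∈ S, M i) s t = ∑ i ∈ S, M i s t :=
  (congrFun (Finset.sum_apply s S M) t).trans (Finset.sum_apply t S fun i => M i s)

theorem takaiFun_mul (F H : CrossedProduct (dualAction α hχ)) :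
    takaiFun α hχ (F * H) = takaiFun α hχ F * takaiFun α hχ H := by
  ext s t
  simp only [takaiFun_apply, CStarMatrix.mul_apply, mul_apply (dualAction α hχ), toMatrix_sum,
    toMatrix_mul, matrix_sum_apply, toMatrix_dualAction, Finset.smul_sum, Finset.sum_mul,
    Finset.mul_sum]
  rw [Finset.sum_comm]
  conv_lhs => enter [2, r]; rw [Finset.sum_comm]
  rw [Finset.sum_comm]
  refine Finset.sum_congr rfl fun p _ => ?_
  conv_rhs => rw [Finset.sum_comm]
  refine Finset.sum_congr rfl fun r _ => ?_
  -- After `g ↦ r⁻¹ * g` the scalars agree, as `χ_g(t) χ_r(p t⁻¹) = χ_r(p) χ_{r⁻¹g}(t)`.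
  refine Fintype.sum_equiv (Equiv.mulLeft r⁻¹) _ _ fun g => ?_
  simp only [Equiv.coe_mulLeft, smul_mul_assoc, mul_smul_comm, smul_smul]
  congr 1
  rw [← Units.val_mul, ← Units.val_mul]
  congr 1
  simp only [map_mul, MonoidHom.mul_apply, map_inv, MonoidHom.inv_apply]
  ac_rfl

theorem takaiFun_star (F : CrossedProduct (dualAction α hχ)) :
    takaiFun α hχ (star F) = star (takaiFun α hχ F) := by
  ext s t
  rw [CStarMatrix.star_apply, takaiFun_apply, takaiFun_apply, star_sum]
  -- The scalars match because `χ_g(t) χ_g(s t⁻¹) = χ_g(s)`, the conjugate of `χ_{g⁻¹}(s)`.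
  refine Fintype.sum_equiv (Equiv.inv G) _ _ fun g => ?_
  rw [star_apply (dualAction α hχ), toMatrix_dualAction, toMatrix_star, CStarMatrix.star_apply,
    star_smul, hχ, smul_smul, Equiv.inv_apply, inv_inv, ← Units.val_mul, ← map_mul,
    mul_comm s, mul_inv_cancel_left]

variable [DecidableEq G]

/-- Fourier inversion of the map of Takai duality. -/
noncomputable def takaiInv (M : CStarMatrix G G A) : CrossedProduct (dualAction α hχ) :=
  ofFun _ fun g => ofFun α fun r =>
    (Fintype.card G : ℂ)⁻¹ • ∑ t, (χ g t⁻¹ : ℂ) • α (r * t) (M (r * t) t)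

/-- Applying `α (r * t)` to the entry `(r * t, t)` gives `∑ h, χ_h(t) F_h(r)`, a Fourier transform
in `h`. Summing over `t` against `χ_g(t⁻¹)` recovers `F_g(r)`. -/
theorem takaiInv_takaiFun
    (h2 : ∀ g, ∑ s, (χ g s : ℂ) = if g = 1 then (Fintype.card G : ℂ) else 0)
    (F : CrossedProduct (dualAction α hχ)) :
    takaiInv α hχ (takaiFun α hχ F) = F := by
  ext g r
  have hα : ∀ s a, α s (α s⁻¹ a) = a := fun s a => by
    rw [← StarAlgEquiv.mul_apply, ← map_mul]; simp
  change (Fintype.card G : ℂ)⁻¹ • ∑ t, (χ g t⁻¹ : ℂ) • α (r * t) (takaiFun α hχ F (r * t) t) = F g r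
  simp only [takaiFun_apply, toMatrix_apply, map_sum, map_smul, hα, mul_inv_cancel_right,
    Finset.smul_sum (r := (χ g _ : ℂ)), smul_smul]
  rw [Finset.sum_comm, inv_smul_eq_iff₀ (Nat.cast_ne_zero.mpr Fintype.card_ne_zero)]
  have hc : ∀ h, ∑ t, ((χ g t⁻¹ : ℂ) * (χ h t : ℂ)) • F h r =
      if g⁻¹ * h = 1 then (Fintype.card G : ℂ) • F h r else 0 := fun h => by
    rw [← Finset.sum_smul, ← ite_zero_smul, ← h2]
    simp
  simp only [hc, inv_mul_eq_one]
  simp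

/-- Here the sum over `g` of `χ_g(t p⁻¹)` selects `p = t`, by the other orthogonality relation. -/
theorem takaiFun_takaiInv
    (h1 : ∀ s, ∑ g, (χ g s : ℂ) = if s = 1 then (Fintype.card G : ℂ) else 0)
    (M : CStarMatrix G G A) :
    takaiFun α hχ (takaiInv α hχ M) = M := by
  ext s t
  have hc : ∀ g, takaiInv α hχ M g (s * t⁻¹) = (Fintype.card G : ℂ)⁻¹ • ∑ p, (χ g p⁻¹ : ℂ) •
      α (s * t⁻¹ * p) (M (s * t⁻¹ * p) p) := fun g => rfl
  have hd : ∀ p, ∑ g, ((χ g t : ℂ) * (χ g p⁻¹ : ℂ)) • α s⁻¹ (α (s * t⁻¹ * p) (M (s * t⁻¹ * p) p)) =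
      if p = t then (Fintype.card G : ℂ) • M s t else 0 := fun p => by
    rw [← Finset.sum_smul]
    simp only [← Units.val_mul, ← map_mul, h1]
    by_cases h : p = t
    · subst h
      rw [inv_mul_cancel_right, ← StarAlgEquiv.mul_apply, ← map_mul]
      simp
    · rw [if_neg (fun h' => h (mul_inv_eq_one.mp h').symm), if_neg h, zero_smul]
  simp only [takaiFun_apply, toMatrix_apply, hc, map_smul, map_sum]
  simp only [smul_comm _ (Fintype.card G : ℂ)⁻¹, ← Finset.smul_sum]
  simp only [Finset.smul_sum (r := (χ _ _ : ℂ)), smul_smul]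
  rw [Finset.sum_comm, inv_smul_eq_iff₀ (Nat.cast_ne_zero.mpr Fintype.card_ne_zero)]
  simp only [hd, Finset.sum_ite_eq', Finset.mem_univ, if_true]

/-- Takai duality for finite abelian groups. -/
noncomputable def takaiEquiv
    (h1 : ∀ s, ∑ g, (χ g s : ℂ) = if s = 1 then (Fintype.card G : ℂ) else 0)
    (h2 : ∀ g, ∑ s, (χ g s : ℂ) = if g = 1 then (Fintype.card G : ℂ) else 0) :
    CrossedProduct (dualAction α hχ) ≃⋆ₐ[ℂ] CStarMatrix G G A where
  toFun := takaiFun α hχ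
  invFun := takaiInv α hχ
  left_inv := takaiInv_takaiFun α hχ h2
  right_inv := takaiFun_takaiInv α hχ h1
  map_mul' := takaiFun_mul α hχ
  map_add' F H := by
    ext s t
    simp [takaiFun_apply, toMatrix_add, Finset.sum_add_distrib]
  map_star' := takaiFun_star α hχ
  map_smul' c F := by
    ext s t
    simp [takaiFun_apply, toMatrix_smul, Finset.smul_sum, smul_comm c]

-- Only the summand `g = 1` survives, and its character is trivial.
omit [DecidableEq G] in
theorem takaiFun_incl (f : CrossedProduct α) :
    takaiFun α hχ (incl (dualAction α hχ) f) = toMatrix α f := by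
  ext s t
  rw [takaiFun_apply, Finset.sum_eq_single 1]
  · simp [incl_apply]
  · intro g _ hg
    simp [incl_apply, hg, toMatrix_apply]
  · simp

end Dual

end CrossedProduct

/-! ### The reverse inclusion by duality, and the equivalences. -/

theorem CrossedProduct.largestIdeal_subset_ofIdeal {P : CStarProperty.{u}}
    (hstable : IsStableProperty P) (hP : AdmitsLargestIdeals P) {G : Type u} [CommGroup G]
    [Fintype G]
    (h : ∀ (A : Type u) [NonUnitalCStarAlgebra A] (α : G →* (A ≃⋆ₐ[ℂ] A)),
      CrossedProduct.ofIdeal α (largestIdeal hP A) ⊆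
        (largestIdeal hP (CrossedProduct α) : Set (CrossedProduct α)))
    (A : Type u) [NonUnitalCStarAlgebra A] (α : G →* (A ≃⋆ₐ[ℂ] A)) :
    (largestIdeal hP (CrossedProduct α) : Set (CrossedProduct α)) ⊆
      CrossedProduct.ofIdeal α (largestIdeal hP A) := by
  classical
  intro f hf s
  obtain ⟨χ, hχ, h1, h2⟩ := exists_pairing G
  have hmem : incl (dualAction α hχ) f ∈ largestIdeal hP (CrossedProduct (dualAction α hχ)) := by
    -- The hypothesis is used for the dual action on the crossed product, not for `α`.
    refine h _ (dualAction α hχ) fun g => ?_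
    rw [incl_apply]
    split_ifs
    · exact hf
    · exact zero_mem _
  -- The entry `(1, s⁻¹)` of the regular representation of `f` is `f s`, with no automorphism
  -- applied.
  have := entry_mem_largestIdeal (takaiEquiv α hχ h1 h2) hstable hP hmem 1 s⁻¹
  change takaiFun α hχ (incl (dualAction α hχ) f) 1 s⁻¹ ∈ _ at this
  rw [takaiFun_incl, toMatrix_apply] at this
  simpa using this

theorem theorem3p5 (P : CStarProperty.{u}) (hstable : IsStableProperty P)
    (hP : AdmitsLargestIdeals P) (G : Type u) [CommGroup G] [Fintype G] :
    List.TFAE [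
      ∀ (A : Type u) [NonUnitalCStarAlgebra A], P A →
        ∀ α : G →* (A ≃⋆ₐ[ℂ] A), P (CrossedProduct α),
      ∀ (A : Type u) [NonUnitalCStarAlgebra A] (α : G →* (A ≃⋆ₐ[ℂ] A)),
        CrossedProduct.ofIdeal α (largestIdeal hP A) ⊆
          (largestIdeal hP (CrossedProduct α) : Set (CrossedProduct α)),
      ∀ (A : Type u) [NonUnitalCStarAlgebra A] (α : G →* (A ≃⋆ₐ[ℂ] A)),
        CrossedProduct.incl α '' (largestIdeal hP A : Set A) ⊆
          (largestIdeal hP (CrossedProduct α) : Set (CrossedProduct α)) ∩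
            Set.range (CrossedProduct.incl α),
      ∀ (A : Type u) [NonUnitalCStarAlgebra A] (α : G →* (A ≃⋆ₐ[ℂ] A)),
        CrossedProduct.ofIdeal α (largestIdeal hP A) =
          (largestIdeal hP (CrossedProduct α) : Set (CrossedProduct α)),
      ∀ (A : Type u) [NonUnitalCStarAlgebra A] (α : G →* (A ≃⋆ₐ[ℂ] A)),
        CrossedProduct.incl α '' (largestIdeal hP A : Set A) =
          (largestIdeal hP (CrossedProduct α) : Set (CrossedProduct α)) ∩
            Set.range (CrossedProduct.incl α)] := by

  tfae_have 1 → 2 := fun h A _ α =>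
    have hI : ∀ g, ∀ a ∈ largestIdeal hP A, α g a ∈ largestIdeal hP A :=
      fun g a ha => apply_mem_largestIdeal hstable hP (α g) ha
    le_largestIdeal hP (J := CrossedProduct.closedIdeal α (largestIdeal hP A) hI)
      (hstable.of_equiv (CrossedProduct.closedIdealEquiv α (largestIdeal hP A) hI)
        (h _ (prop_largestIdeal hP A) _))
  -- When `A` has `P` its largest ideal is `A`, so the left side of 2 is the whole crossed product.
  tfae_have 2 → 1 := fun h A _ hA α =>
    (prop_iff_forall_mem_largestIdeal hstable hP).mpr fun _ =>
      h A α fun _ => (prop_iff_forall_mem_largestIdeal hstable hP).mp hA _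
  tfae_have 2 → 3 := by
    rintro h A _ α _ ⟨a, ha, rfl⟩
    refine ⟨h A α fun s => ?_, a, rfl⟩
    rw [CrossedProduct.incl_apply]
    split_ifs
    · exact ha
    · exact zero_mem _
  tfae_have 3 → 2 := fun h A _ α _ hf =>
    CrossedProduct.mem_of_incl_mem α (fun a ha => (h A α ⟨a, ha, rfl⟩).1) hf
  tfae_have 2 → 4 := fun h A _ α =>
    (h A α).antisymm (CrossedProduct.largestIdeal_subset_ofIdeal hstable hP h A α)
  tfae_have 4 → 5 := by
    intro h A _ α
    rw [← h A α]
    ext f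
    constructor
    · rintro ⟨a, ha, rfl⟩
      refine ⟨fun s => ?_, a, rfl⟩
      rw [CrossedProduct.incl_apply]
      split_ifs
      · exact ha
      · exact zero_mem _
    · rintro ⟨hf, a, rfl⟩
      refine ⟨a, ?_, rfl⟩
      simpa [CrossedProduct.incl_apply] using hf 1
  tfae_have 5 → 3 := fun h A _ α => (h A α).subset
  tfae_finish
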